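/- Let $K\subset\mathbb{C}$ be closed and let $\mathcal M(K)$ be the set of Borel probability measures on $K$ with the topology of weak convergence (duality with bounded continuous functions on $K$). For a compact set $C\subset\mathbb{C}$ and $\mu\in\mathcal M(C)$ put $I(\mu)=\iint\log\frac1{|z-t|}\,d\mu(z)\,d\mu(t)\in(-\infty,\infty]$; a Borel set $E\subset\mathbb{C}$ is polar if $I(\mu)=\infty$ for every compact $C\subset E$ and every $\mu\in\mathcal M(C)$. Assume that $K$ is nonpolar and that $Q:K\to(-\infty,\infty]$ is weakly admissible: $Q$ is lower semicontinuous, $\{z\in K:Q(z)<\infty\}$ is nonpolar, and there is $M\in(-\infty,\infty)$ with $$\liminf_{z\in K,\ |z|\to\infty}\bigl(Q(z)-\log|z|\bigr)=M$$ (so that $K$ is unbounded). Put $w=e^{-Q}$ and, for $\mu\in\mathcal M(K)$, $$I^Q(\mu)=\int_K\int_K\log\frac{1}{|z-t|\,w(z)\,w(t)}\,d\mu(z)\,d\mu(t)\in(-\infty,\infty],\qquad V_w=\inf_{\mu\in\mathcal M(K)}I^Q(\mu).$$ For $k\ge2$ and $x_1,\dots,x_k\in K$ put $$|VDM_k^Q(x_1,\dots,x_k)|=\prod_{i<j}|x_i-x_j|\,w(x_i)\,w(x_j),\qquad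 \delta_k^Q(K)=\sup_{x_1,\dots,x_k\in K}|VDM_k^Q(x_1,\dots,x_k)|^{2/(k(k-1))}.$$ Then $V_w$ is finite, there is a unique $\mu_{K,Q}\in\mathcal M(K)$ with $I^Q(\mu_{K,Q})=V_w$, the weighted diameters $\delta_k^Q(K)$, $k\ge2$, are finite, and: 1. If $x_j^{(k)}\in K$ ($1\le j\le k$, $k\ge 2$) and the measures $\mu_k=\frac1k\sum_{j=1}^k\delta_{x_j^{(k)}}$ converge weakly to $\mu\in\mathcal M(K)$, then $$\limsup_{k\to\infty}|VDM_k^Q(x_1^{(k)},\dots,x_k^{(k)})|^{2/(k(k-1))}\le\exp(-I^Q(\mu)),$$ where $\exp(-\infty)=0$. 2. $\lim_{k\to\infty}\delta_k^Q(K)=\exp(-V_w)$. 3. If $x_j^{(k)}\in K$ ($1\le j\le k$, $k\ge 2$) and $$\lim_{k\to\infty}|VDM_k^Q(x_1^{(k)},\dots,x_k^{(k)})|^{2/(k(k-1))}=\exp(-V_w),$$ then $\mu_k=\frac1k\sum_{j=1}^k\delta_{x_j^{(k)}}\to\mu_{K,Q}$ weakly. -/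

import Mathlib

open MeasureTheory Filter Topology
open scoped ENNReal NNReal

namespace LogPotential

noncomputable section

/-- The integral of an extended-real function: the integral of its positive part minus the
integral of its negative part. It is meaningful when one of the two is finite; in particular for a
Borel function bounded below and a finite measure, where it takes values in `(-∞, ∞]`. -/
def erealIntegral {α : Type*} [MeasurableSpace α] (μ : Measure α) (f : α → EReal) : EReal :=
  ((∫⁻ a, (f a).toENNReal ∂μ : ℝ≥0∞) : EReal) - ((∫⁻ a, (-f a).toENNReal ∂μ : ℝ≥0∞) : EReal)

/-- The logarithmic energy `I(μ) = ∬ log (1 / |z - t|) dμ(z) dμ(t)`, with `log (1 / 0) = ∞`. It is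
used below for compact `E` only, where the integrand is bounded below. -/
def logEnergy {E : Set ℂ} (μ : ProbabilityMeasure E) : EReal :=
  erealIntegral ((μ : Measure E).prod (μ : Measure E))
    (fun p => ENNReal.log (edist p.1 p.2)⁻¹)

/-- A set is polar if every probability measure on a compact subset of it has infinite
logarithmic energy. -/
def IsPolar (E : Set ℂ) : Prop :=
  ∀ C : Set ℂ, C ⊆ E → IsCompact C → ∀ μ : ProbabilityMeasure C, logEnergy μ = ⊤

/-- A weakly admissible weight `Q : K → (-∞, ∞]`: lower semicontinuous, finite on a nonpolar set,
and such that `liminf (Q z - log |z|)`, as `|z| → ∞` in `K`, is a real number. The last condition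
forces `K` to be unbounded, since a liminf along the trivial filter is `∞`. -/
structure IsWeaklyAdmissible {K : Set ℂ} (Q : K → EReal) : Prop where
  ne_bot : ∀ z, Q z ≠ ⊥
  lowerSemicontinuous : LowerSemicontinuous Q
  nonpolar : ¬ IsPolar {z : ℂ | ∃ h : z ∈ K, Q ⟨z, h⟩ < ⊤}
  liminf_eq : ∃ M : ℝ,
    liminf (fun z : K => Q z - ((Real.log ‖(z : ℂ)‖ : ℝ) : EReal))
      (comap (fun z : K => ‖(z : ℂ)‖) atTop) = (M : EReal)

/-- `w = e^{-Q}`, which lies in `[0, ∞)` when `Q` takes values in `(-∞, ∞]`. -/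
def weight {K : Set ℂ} (Q : K → EReal) (z : K) : ℝ≥0∞ := EReal.exp (-Q z)

/-- The weighted logarithmic energy
`I^Q(μ) = ∬ log (1 / (|z - t| w(z) w(t))) dμ(z) dμ(t)`, with `log (1 / 0) = ∞`. -/
def weightedEnergy {K : Set ℂ} (Q : K → EReal) (μ : ProbabilityMeasure K) : EReal :=
  erealIntegral ((μ : Measure K).prod (μ : Measure K))
    (fun p => ENNReal.log (edist p.1 p.2 * weight Q p.1 * weight Q p.2)⁻¹)

/-- `V_w`, the infimum of the weighted energy over all probability measures on `K`. -/
def minEnergy {K : Set ℂ} (Q : K → EReal) : EReal :=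
  ⨅ μ : ProbabilityMeasure K, weightedEnergy Q μ

/-- The weighted Vandermonde `∏_{i < j} |x_i - x_j| w(x_i) w(x_j)`. -/
def weightedVDM {K : Set ℂ} (Q : K → EReal) {k : ℕ} (x : Fin k → K) : ℝ≥0∞ :=
  ∏ i : Fin k, ∏ j ∈ Finset.Ioi i, edist (x i) (x j) * weight Q (x i) * weight Q (x j)

/-- `|VDM_k^Q(x_1, ..., x_k)|^{2 / (k (k - 1))}`, of interest for `k ≥ 2`. -/
def normalizedVDM {K : Set ℂ} (Q : K → EReal) {k : ℕ} (x : Fin k → K) : ℝ≥0∞ :=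
  weightedVDM Q x ^ (2 / ((k : ℝ) * ((k : ℝ) - 1)))

/-- The `k`-th weighted diameter, a supremum in `[0, ∞]`. -/
def weightedDiameter {K : Set ℂ} (Q : K → EReal) (k : ℕ) : ℝ≥0∞ :=
  ⨆ x : Fin k → K, normalizedVDM Q x

/-- The measure `(1 / k) ∑ δ_{x_j}`. It is a probability measure for `k ≥ 1`, and `0` for
`k = 0`; it is therefore typed as a finite measure. The weak topology of probability measures is
the one induced from that of finite measures. -/
def empiricalMeasure {K : Set ℂ} {k : ℕ} (x : Fin k → K) : FiniteMeasure K :=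
  ((k : ℝ≥0)⁻¹) • ∑ j : Fin k, (diracProba (x j)).toFiniteMeasure

end

end LogPotential

open LogPotential

/-! Everything is moved to the Riemann sphere. The kernel `log (1 / (|z - t| w(z) w(t)))` is the
logarithmic kernel of the chordal distance plus the fields `Q - sphereWeight` at the two points.
Weak admissibility bounds these fields below by `-c`. After adding `2c` the kernel is nonnegative
and lower semicontinuous (`weightedKernel`), and `expNeg c` turns its energies and discrete energies
into the exponentials and Vandermondes of the statement (`weightedEnergy_eq`, `normalizedVDM_eq`).

For such a kernel, truncation at `N` costs a configuration only `N / k` on the diagonal, so discrete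
energies are asymptotically at least the energy of the weak limit (`eventually_lt_discreteEnergy`).
Conversely, averaging over independent points of law `μ` gives a configuration of discrete energy at
most that of `μ` (`exists_discreteEnergy_le`). The field need not grow at infinity, but two distant
points are close on the sphere and repel strongly. Mass therefore cannot escape, and bounded
discrete energy gives tightness (`exists_isCompact_eventually_mem`). Limits of the diameters and
existence of a minimizer follow.

Uniqueness is strict positive definiteness: the chordal kernel is a power series with positive
coefficients in a Gram kernel, so equality in the energy inequality forces equal moments, and
Stone–Weierstrass identifies the measures (`eq_of_chordalEnergy_le`). -/

namespace LogPotential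

/-! ### Lower semicontinuity of integrals under weak convergence -/

lemma le_tsum_staircase (a : ℝ≥0∞) {ε : ℝ≥0∞} (hε : ε ≠ 0) :
    a ≤ ε + ∑' n : ℕ, if (n + 1 : ℝ≥0∞) * ε < a then ε else 0 := by
  classical
  by_cases h : ∃ n : ℕ, a ≤ (n + 1 : ℝ≥0∞) * ε
  · have hlt : ∀ m < Nat.find h, (m + 1 : ℝ≥0∞) * ε < a := fun m hm =>
      not_le.1 (Nat.find_min h hm)
    calc a ≤ (Nat.find h + 1 : ℝ≥0∞) * ε := Nat.find_spec h
      _ = ε + ∑ n ∈ Finset.range (Nat.find h),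
            (if (n + 1 : ℝ≥0∞) * ε < a then ε else 0) := by
          rw [Finset.sum_congr rfl fun n hn => if_pos (hlt n (Finset.mem_range.1 hn))]
          simp [add_mul, add_comm]
      _ ≤ _ := by gcongr; exact ENNReal.sum_le_tsum _
  · push Not at h
    rw [tsum_congr fun n => if_pos (h n), ENNReal.tsum_const_eq_top_of_ne_zero hε]
    simp

/-- With `le_tsum_staircase`, this approximates a function within `ε` by a sum of indicators of
strict superlevel sets, which are open when the function is lower semicontinuous. -/
lemma tsum_staircase_le (a ε : ℝ≥0∞) :
    ∑' n : ℕ, (if (n + 1 : ℝ≥0∞) * ε < a then ε else 0) ≤ a := by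
  refine ENNReal.tsum_le_of_sum_range_le fun n => ?_
  induction n with
  | zero => simp
  | succ n ih =>
    by_cases h : (n + 1 : ℝ≥0∞) * ε < a
    · have : ∑ i ∈ Finset.range (n + 1), (if (i + 1 : ℝ≥0∞) * ε < a then ε else 0)
          ≤ ∑ i ∈ Finset.range (n + 1), ε := Finset.sum_le_sum fun i _ => by split_ifs <;> simp
      refine this.trans (le_trans ?_ h.le)
      simp
    · rw [Finset.sum_range_succ, if_neg h, add_zero]
      exact ih

section Weak

variable {Y : Type*} [TopologicalSpace Y] [MeasurableSpace Y] [BorelSpace Y]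

lemma lowerSemicontinuous_measure_of_isOpen [HasOuterApproxClosed Y] {U : Set Y} (hU : IsOpen U) :
    LowerSemicontinuous fun μ : ProbabilityMeasure Y => (μ : Measure Y) U :=
  lowerSemicontinuous_iff_le_liminf.2 fun _ =>
    ProbabilityMeasure.le_liminf_measure_open_of_tendsto tendsto_id hU

lemma lowerSemicontinuous_const_mul {α : Type*} [TopologicalSpace α] {f : α → ℝ≥0∞}
    (hf : LowerSemicontinuous f) {c : ℝ≥0∞} (hc : c ≠ ⊤) :
    LowerSemicontinuous fun a => c * f a :=
  (ENNReal.continuous_const_mul hc).comp_lowerSemicontinuous hf fun _ _ h => by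
    dsimp only; gcongr

/-- Integrating a lower semicontinuous function is lower semicontinuous in the measure. -/
lemma lowerSemicontinuous_lintegral [HasOuterApproxClosed Y] {f : Y → ℝ≥0∞}
    (hf : LowerSemicontinuous f) :
    LowerSemicontinuous fun μ : ProbabilityMeasure Y => ∫⁻ y, f y ∂(μ : Measure Y) := by
  intro μ c hc
  obtain ⟨ε, hε, hcε⟩ : ∃ ε : ℝ≥0, 0 < ε ∧ c + ε < ∫⁻ y, f y ∂(μ : Measure Y) := by
    obtain ⟨r, hr, hr'⟩ := ENNReal.lt_iff_exists_add_pos_lt.1 hc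
    exact ⟨r, hr, hr'⟩
  have hε0 : (ε : ℝ≥0∞) ≠ 0 := by simpa using hε.ne'
  let U : ℕ → Set Y := fun n => {y | (n + 1 : ℝ≥0∞) * ε < f y}
  have hU : ∀ n, IsOpen (U n) := fun n => hf.isOpen_preimage _
  let S : Y → ℝ≥0∞ := fun y => ∑' n : ℕ, if (n + 1 : ℝ≥0∞) * ε < f y then (ε : ℝ≥0∞) else 0
  have hS : ∀ ν : ProbabilityMeasure Y,
      ∫⁻ y, S y ∂(ν : Measure Y) = ∑' n, ε * (ν : Measure Y) (U n) := by
    intro ν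
    have : ∀ n : ℕ, (fun y => if (n + 1 : ℝ≥0∞) * ε < f y then (ε : ℝ≥0∞) else 0) =
        (U n).indicator fun _ => (ε : ℝ≥0∞) := by
      intro n; ext y; simp [U, Set.indicator_apply]
    simp_rw [S]
    rw [lintegral_tsum]
    · refine tsum_congr fun n => ?_
      rw [this n, lintegral_indicator_const (hU n).measurableSet]
    · intro n
      rw [this n]
      exact (measurable_const.indicator (hU n).measurableSet).aemeasurable
  have hlsc : LowerSemicontinuous fun ν : ProbabilityMeasure Y =>
      ∑' n, ε * (ν : Measure Y) (U n) :=
    lowerSemicontinuous_tsum fun n =>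
      lowerSemicontinuous_const_mul (lowerSemicontinuous_measure_of_isOpen (hU n))
        ENNReal.coe_ne_top
  have hμ : c < ∑' n, ε * (μ : Measure Y) (U n) := by
    rw [← hS]
    have : ∫⁻ y, f y ∂(μ : Measure Y) ≤ ε + ∫⁻ y, S y ∂(μ : Measure Y) := by
      calc ∫⁻ y, f y ∂(μ : Measure Y) ≤ ∫⁻ y, (ε + S y) ∂(μ : Measure Y) :=
            lintegral_mono fun y => le_tsum_staircase _ hε0
        _ = _ := by rw [lintegral_add_left measurable_const]; simp
    have h := hcε.trans_le this
    rw [add_comm] at h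
    exact (ENNReal.add_lt_add_iff_left ENNReal.coe_ne_top).1 h
  filter_upwards [hlsc μ c hμ] with ν hν
  refine hν.trans_le ?_
  rw [← hS]
  exact lintegral_mono fun y => tsum_staircase_le _ _

end Weak

/-! ### Continuous and discrete energies of a nonnegative kernel -/

noncomputable section

variable {X : Type*} [MeasurableSpace X]

/-- The energy of a measure with respect to a kernel with values in `[0, ∞]`. -/
def energy (h : X × X → ℝ≥0∞) (μ : Measure X) : ℝ≥0∞ := ∫⁻ p, h p ∂μ.prod μ

/-- The mean of a kernel over the pairs of distinct indices of a configuration. -/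
def discreteEnergy (h : X × X → ℝ≥0∞) {k : ℕ} (x : Fin k → X) : ℝ≥0∞ :=
  (∑ i, ∑ j ∈ Finset.univ.erase i, h (x i, x j)) / (k * (k - 1 : ℕ))

/-- The normalized counting measure of a configuration. -/
def normalizedCount {k : ℕ} (x : Fin k → X) : Measure X :=
  (k : ℝ≥0∞)⁻¹ • ∑ j, Measure.dirac (x j)

lemma isProbabilityMeasure_normalizedCount {k : ℕ} (hk : k ≠ 0) (x : Fin k → X) :
    IsProbabilityMeasure (normalizedCount x) := by
  refine ⟨?_⟩
  simp [normalizedCount, ENNReal.inv_mul_cancel, hk]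

lemma lintegral_normalizedCount {k : ℕ} (x : Fin k → X) {f : X → ℝ≥0∞} (hf : Measurable f) :
    ∫⁻ y, f y ∂normalizedCount x = (k : ℝ≥0∞)⁻¹ * ∑ j, f (x j) := by
  simp [normalizedCount, lintegral_smul_measure, lintegral_dirac' _ hf]

lemma energy_normalizedCount {k : ℕ} (hk : k ≠ 0) (x : Fin k → X) {h : X × X → ℝ≥0∞}
    (hh : Measurable h) :
    energy h (normalizedCount x) = (k : ℝ≥0∞)⁻¹ * ((k : ℝ≥0∞)⁻¹ * ∑ i, ∑ j, h (x i, x j)) := by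
  have := isProbabilityMeasure_normalizedCount hk x
  rw [energy, lintegral_prod _ hh.aemeasurable,
    lintegral_normalizedCount x hh.lintegral_prod_right']
  congr 1
  rw [Finset.mul_sum]
  refine Finset.sum_congr rfl fun i _ => ?_
  exact lintegral_normalizedCount x (hh.comp measurable_prodMk_left)

/-- Truncating the kernel makes the diagonal contribute little to the energy of a configuration. -/
lemma energy_min_normalizedCount_le {k : ℕ} (hk : 2 ≤ k) (x : Fin k → X) {h : X × X → ℝ≥0∞}
    (hh : Measurable h) (N : ℝ≥0) :
    energy (fun p => min (h p) N) (normalizedCount x) ≤ discreteEnergy h x + N / k := by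
  have hk0 : (k : ℝ≥0∞) ≠ 0 := by simp; omega
  have hkt : (k : ℝ≥0∞) ≠ ⊤ := by simp
  rw [energy_normalizedCount (by omega) x (hh.min measurable_const)]
  have h1 : ∑ i, ∑ j, min (h (x i, x j)) N ≤
      (∑ i, ∑ j ∈ Finset.univ.erase i, h (x i, x j)) + k * N := by
    calc ∑ i, ∑ j, min (h (x i, x j)) N
        ≤ ∑ i, (∑ j ∈ Finset.univ.erase i, h (x i, x j) + N) := by
          refine Finset.sum_le_sum fun i _ => ?_
          rw [← Finset.sum_erase_add _ _ (Finset.mem_univ i)]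
          gcongr
          · exact min_le_left _ _
          · exact min_le_right _ _
      _ = _ := by simp [Finset.sum_add_distrib]
  calc (k : ℝ≥0∞)⁻¹ * ((k : ℝ≥0∞)⁻¹ * ∑ i, ∑ j, min (h (x i, x j)) N)
      ≤ (k : ℝ≥0∞)⁻¹ * ((k : ℝ≥0∞)⁻¹ *
          ((∑ i, ∑ j ∈ Finset.univ.erase i, h (x i, x j)) + k * N)) := by gcongr
    _ = (k * k : ℝ≥0∞)⁻¹ * (∑ i, ∑ j ∈ Finset.univ.erase i, h (x i, x j)) + N / k := by
        rw [mul_add (k : ℝ≥0∞)⁻¹, ← mul_assoc (k : ℝ≥0∞)⁻¹ k, ENNReal.inv_mul_cancel hk0 hkt,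
          one_mul, mul_add, ENNReal.mul_inv (.inl hk0) (.inl hkt), mul_assoc, ENNReal.div_eq_inv_mul]
    _ ≤ _ := by
        -- The weight `1 / k²` of the product measure is at most the weight `1 / (k (k - 1))` of the
        -- mean over pairs.
        rw [discreteEnergy, ENNReal.div_eq_inv_mul (b := k * _)]
        gcongr
        exact Nat.sub_le k 1

/-- For `k` independent points of law `μ`, each pair of distinct indices has expected kernel value
`energy h μ`. Some configuration does not exceed the mean. -/
lemma exists_discreteEnergy_le {k : ℕ} (hk : 2 ≤ k) {h : X × X → ℝ≥0∞} (hh : Measurable h)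
    (μ : Measure X) [IsProbabilityMeasure μ] :
    ∃ x : Fin k → X, discreteEnergy h x ≤ energy h μ := by
  have hm : ∀ i j : Fin k, Measurable fun x : Fin k → X => h (x i, x j) := fun i j =>
    hh.comp ((measurable_pi_apply i).prodMk (measurable_pi_apply j))
  have hpair : ∀ i j : Fin k, j ∈ Finset.univ.erase i →
      ∫⁻ x : Fin k → X, h (x i, x j) ∂Measure.pi (fun _ => μ) = energy h μ := by
    intro i j hij
    have hind := (ProbabilityTheory.iIndepFun_pi (μ := fun _ : Fin k => μ) (X := fun _ => id)
      fun _ => aemeasurable_id).indepFun (Finset.ne_of_mem_erase hij).symm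
    have hmap := (ProbabilityTheory.indepFun_iff_map_prod_eq_prod_map_map
      (measurable_pi_apply i).aemeasurable (measurable_pi_apply j).aemeasurable).1 hind
    have hmarg : ∀ l : Fin k, Measure.map (fun x : Fin k → X => x l)
        (Measure.pi fun _ => μ) = μ := fun l =>
      (measurePreserving_eval (fun _ : Fin k => μ) l).map_eq
    rw [hmarg i, hmarg j] at hmap
    rw [energy, ← hmap, lintegral_map hh ((measurable_pi_apply i).prodMk (measurable_pi_apply j))]
  have hint : ∫⁻ x : Fin k → X, discreteEnergy h x ∂Measure.pi (fun _ => μ) = energy h μ := by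
    simp_rw [discreteEnergy, ENNReal.div_eq_inv_mul]
    rw [lintegral_const_mul _ (by fun_prop), lintegral_finsetSum _ (fun i _ => by fun_prop)]
    simp_rw [fun i : Fin k => lintegral_finsetSum (μ := Measure.pi (fun _ : Fin k => μ))
      (Finset.univ.erase i) (fun j _ => hm i j)]
    rw [Finset.sum_congr rfl fun i _ => Finset.sum_congr rfl (hpair i)]
    simp only [Finset.sum_const, Finset.card_erase_of_mem (Finset.mem_univ _), Finset.card_univ,
      Fintype.card_fin, nsmul_eq_mul]
    rw [← mul_assoc (k : ℝ≥0∞), ← mul_assoc, ENNReal.inv_mul_cancel, one_mul]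
    · simp only [ne_eq, mul_eq_zero, Nat.cast_eq_zero]; omega
    · exact ENNReal.mul_ne_top (by simp) (by simp)
  rw [← hint]
  refine exists_le_lintegral (Measurable.aemeasurable ?_)
  unfold discreteEnergy
  fun_prop

end

/-! ### Asymptotics of discrete energies for coercive kernels -/

section Convergence

variable {X : Type*} [TopologicalSpace X] [TopologicalSpace.PseudoMetrizableSpace X]
  [SecondCountableTopology X] [MeasurableSpace X] [BorelSpace X]

lemma lowerSemicontinuous_energy {h : X × X → ℝ≥0∞} (hh : LowerSemicontinuous h) :
    LowerSemicontinuous fun μ : ProbabilityMeasure X => energy h (μ : Measure X) :=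
  (lowerSemicontinuous_lintegral hh).comp
    (ProbabilityMeasure.continuous_prod.comp (continuous_id.prodMk continuous_id))

lemma lowerSemicontinuous_min_const {α : Type*} [TopologicalSpace α] {f : α → ℝ≥0∞}
    (hf : LowerSemicontinuous f) (c : ℝ≥0∞) : LowerSemicontinuous fun a => min (f a) c :=
  hf.inf lowerSemicontinuous_const

omit [TopologicalSpace.PseudoMetrizableSpace X] in
-- Monotone convergence. A bounded kernel is needed because the kernel may be infinite on the
-- diagonal, which counting measures charge.
lemma exists_lt_energy_min {h : X × X → ℝ≥0∞} (hh : LowerSemicontinuous h) {μ : Measure X}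
    {c : ℝ≥0∞} (hc : c < energy h μ) : ∃ N : ℝ≥0, c < energy (fun p => min (h p) N) μ := by
  have hsup : energy h μ = ⨆ n : ℕ, energy (fun p => min (h p) (n : ℝ≥0)) μ := by
    unfold energy
    rw [← lintegral_iSup]
    · refine lintegral_congr fun p => ?_
      refine le_antisymm ?_ (iSup_le fun n => min_le_left _ _)
      refine le_of_forall_lt fun b hb => ?_
      obtain ⟨n, hn⟩ := ENNReal.exists_nat_gt (ne_top_of_lt hb)
      refine lt_of_lt_of_le (lt_min hb ?_)
        (le_iSup (fun n : ℕ => min (h p) ((n : ℝ≥0) : ℝ≥0∞)) n)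
      simpa using hn
    · exact fun n => (lowerSemicontinuous_min_const hh _).measurable
    · intro m n hmn p
      dsimp only
      gcongr
  rw [hsup] at hc
  obtain ⟨n, hn⟩ := lt_iSup_iff.1 hc
  exact ⟨n, hn⟩

lemma tendsto_const_div_natCast (N : ℝ≥0) :
    Tendsto (fun k : ℕ => (N : ℝ≥0∞) / k) atTop (𝓝 0) := by
  simpa using ENNReal.Tendsto.const_div (a := (N : ℝ≥0∞)) ENNReal.tendsto_nat_nhds_top
    (.inr ENNReal.coe_ne_top)

/-- Along configurations whose counting measures converge weakly, the discrete energies are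
asymptotically at least the energy of the limit. -/
lemma eventually_lt_discreteEnergy {h : X × X → ℝ≥0∞} (hh : LowerSemicontinuous h)
    {x : (k : ℕ) → Fin k → X} {P : ℕ → ProbabilityMeasure X}
    (hP : ∀ᶠ k in atTop, (P k : Measure X) = normalizedCount (x k))
    {L : Filter ℕ} (hL : L ≤ atTop) {μ : ProbabilityMeasure X} (hμ : Tendsto P L (𝓝 μ))
    {c : ℝ≥0∞} (hc : c < energy h (μ : Measure X)) :
    ∀ᶠ k in L, c < discreteEnergy h (x k) := by
  obtain ⟨N, hN⟩ := exists_lt_energy_min hh hc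
  obtain ⟨ε, hε, hcε⟩ := ENNReal.lt_iff_exists_add_pos_lt.1 hN
  have h1 := hμ.eventually (lowerSemicontinuous_energy (lowerSemicontinuous_min_const hh N) μ _ hcε)
  have h2 : ∀ᶠ k : ℕ in atTop, (N : ℝ≥0∞) / k < ε :=
    (tendsto_const_div_natCast N).eventually_lt_const (by simpa using hε)
  filter_upwards [h1, hL h2, hL hP, hL (eventually_ge_atTop 2)] with k h1 h2 hP hk
  rw [hP] at h1
  have h3 := h1.trans_le (energy_min_normalizedCount_le hk (x k) hh.measurable N)
  by_contra hle
  exact absurd (h3.trans_le (add_le_add (not_lt.1 hle) h2.le)) (lt_irrefl _)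

/-- A kernel that is large when both points are far out. -/
def IsCoerciveKernel (h : X × X → ℝ≥0∞) : Prop :=
  ∀ N : ℝ≥0, ∃ C : Set X, IsCompact C ∧ ∀ x ∉ C, ∀ y ∉ C, (N : ℝ≥0∞) ≤ h (x, y)

omit [TopologicalSpace.PseudoMetrizableSpace X] [SecondCountableTopology X] in
-- Chebyshev's inequality on `Cᶜ ×ˢ Cᶜ`, for the truncated kernel so that it applies to counting
-- measures.
lemma mul_measure_compl_sq_le {h : X × X → ℝ≥0∞} {C : Set X} (hC : IsClosed C) {N : ℝ≥0}
    (hN : ∀ x ∉ C, ∀ y ∉ C, (N : ℝ≥0∞) ≤ h (x, y)) (μ : Measure X) [SFinite μ] :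
    N * (μ Cᶜ * μ Cᶜ) ≤ energy (fun p => min (h p) N) μ := by
  rw [← Measure.prod_prod, ← lintegral_indicator_const (hC.measurableSet.compl.prod
    hC.measurableSet.compl)]
  refine lintegral_mono fun p => ?_
  by_cases hp : p ∈ Cᶜ ×ˢ Cᶜ
  · rw [Set.indicator_of_mem hp]
    exact le_min (hN _ hp.1 _ hp.2) le_rfl
  · simp [Set.indicator_of_notMem hp]

omit [TopologicalSpace.PseudoMetrizableSpace X] in
/-- Configurations of bounded discrete energy have tight counting measures. -/
lemma exists_isCompact_eventually_mem [T2Space X] {h : X × X → ℝ≥0∞} (hh : LowerSemicontinuous h)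
    (hcoer : IsCoerciveKernel h)
    {x : (k : ℕ) → Fin k → X} {P : ℕ → ProbabilityMeasure X}
    (hP : ∀ᶠ k in atTop, (P k : Measure X) = normalizedCount (x k))
    {B : ℝ≥0} (hB : ∀ᶠ k in atTop, discreteEnergy h (x k) ≤ B) :
    ∃ S : Set (ProbabilityMeasure X), IsCompact S ∧ ∀ᶠ k in atTop, P k ∈ S := by
  obtain ⟨k₁, hk₁⟩ := eventually_atTop.1 (hP.and (hB.and (eventually_ge_atTop 2)))
  refine ⟨closure (P '' Set.Ici k₁), isCompact_closure_of_isTightMeasureSet ?_,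
    (eventually_ge_atTop k₁).mono fun k hk => subset_closure ⟨k, hk, rfl⟩⟩
  rw [isTightMeasureSet_iff_exists_isCompact_measure_compl_le]
  intro ε' hε'
  obtain ⟨ε, hε, hεε'⟩ : ∃ ε : ℝ≥0, 0 < ε ∧ (ε : ℝ≥0∞) ≤ ε' := by
    obtain ⟨ε, h0, h1⟩ := ENNReal.lt_iff_exists_nnreal_btwn.1 hε'
    exact ⟨ε, by simpa using h0, h1.le⟩
  -- Mass above `ε` outside `C` would cost more than `N ε² ≥ B + 1`, while the truncated energy is
  -- at most `B + N / k`.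
  obtain ⟨N, hN0, hN⟩ : ∃ N : ℝ≥0, 0 < N ∧ B + 1 ≤ N * (ε * ε) :=
    ⟨(B + 1) / (ε * ε), by positivity, by rw [div_mul_cancel₀ _ (by positivity)]⟩
  obtain ⟨C, hC, hCN⟩ := hcoer N
  obtain ⟨k₂, hk₂⟩ := eventually_atTop.1
    ((tendsto_const_div_natCast N).eventually_lt_const one_pos)
  -- The indices with `N / k` not yet below `1` are handled by adding their finite supports to the
  -- compact set.
  refine ⟨C ∪ ⋃ k ∈ Finset.range k₂, Set.range (x k),
    hC.union ((Finset.range k₂).isCompact_biUnion fun k _ => (Set.finite_range _).isCompact), ?_⟩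
  rintro _ ⟨_, ⟨k, hk, rfl⟩, rfl⟩
  obtain ⟨hPk, hBk, h2k⟩ := hk₁ k hk
  refine le_trans ?_ hεε'
  rcases lt_or_ge k k₂ with hkk | hkk
  · have hsub : (C ∪ ⋃ k ∈ Finset.range k₂, Set.range (x k))ᶜ ⊆ (Set.range (x k))ᶜ :=
      Set.compl_subset_compl.2 fun y hy => .inr (Set.mem_biUnion (by simpa using hkk) hy)
    have h0 : (P k : Measure X) (Set.range (x k))ᶜ = 0 := by
      rw [hPk]
      have hm : MeasurableSet (Set.range (x k))ᶜ := (Set.finite_range _).measurableSet.compl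
      simp [normalizedCount, Measure.dirac_apply' _ hm]
    exact ((measure_mono hsub).trans h0.le).trans (zero_le)
  · refine (measure_mono (Set.compl_subset_compl.2 Set.subset_union_left)).trans ?_
    have h3 := (mul_measure_compl_sq_le hC.isClosed hCN (P k : Measure X)).trans
      ((hPk ▸ energy_min_normalizedCount_le h2k (x k) hh.measurable N).trans
        (add_le_add hBk (hk₂ k hkk).le))
    by_contra hlt
    rw [not_le] at hlt
    have h4 : (N : ℝ≥0∞) * (ε * ε) < N * ((P k : Measure X) Cᶜ * (P k : Measure X) Cᶜ) :=
      (ENNReal.mul_lt_mul_iff_right (by simpa using hN0.ne') ENNReal.coe_ne_top).2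
        (ENNReal.mul_lt_mul hlt hlt)
    have h5 : (B : ℝ≥0∞) + 1 ≤ N * (ε * ε) := by exact_mod_cast hN
    exact absurd (h5.trans_lt (h4.trans_le h3)) (lt_irrefl _)

omit [TopologicalSpace.PseudoMetrizableSpace X] in
/-- Along an ultrafilter, configurations of bounded discrete energy have convergent counting
measures. -/
lemma exists_tendsto_of_discreteEnergy_le [T2Space X] {h : X × X → ℝ≥0∞}
    (hh : LowerSemicontinuous h) (hcoer : IsCoerciveKernel h)
    {x : (k : ℕ) → Fin k → X} {P : ℕ → ProbabilityMeasure X}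
    (hP : ∀ᶠ k in atTop, (P k : Measure X) = normalizedCount (x k))
    {B : ℝ≥0} (hB : ∀ᶠ k in atTop, discreteEnergy h (x k) ≤ B)
    (U : Ultrafilter ℕ) (hU : (U : Filter ℕ) ≤ atTop) :
    ∃ μ : ProbabilityMeasure X, Tendsto P U (𝓝 μ) := by
  obtain ⟨S, hS, hPS⟩ := exists_isCompact_eventually_mem hh hcoer hP hB
  obtain ⟨μ, -, hμ⟩ := hS.ultrafilter_le_nhds (U.map P) (le_principal_iff.2 (hU hPS))
  exact ⟨μ, hμ⟩

/-- If the discrete energies converge to the infimum of the energy, which is attained at one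
measure only, then the counting measures converge to that measure. -/
lemma tendsto_of_tendsto_discreteEnergy [T2Space X] {h : X × X → ℝ≥0∞}
    (hh : LowerSemicontinuous h) (hcoer : IsCoerciveKernel h)
    {x : (k : ℕ) → Fin k → X} {P : ℕ → ProbabilityMeasure X}
    (hP : ∀ᶠ k in atTop, (P k : Measure X) = normalizedCount (x k))
    {V : ℝ≥0∞} (hV : V ≠ ⊤) {μ₀ : ProbabilityMeasure X}
    (huniq : ∀ μ : ProbabilityMeasure X, energy h (μ : Measure X) ≤ V → μ = μ₀)
    (hx : Tendsto (fun k => discreteEnergy h (x k)) atTop (𝓝 V)) :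
    Tendsto P atTop (𝓝 μ₀) := by
  have hB : ∀ᶠ k in atTop, discreteEnergy h (x k) ≤ (V.toNNReal + 1 : ℝ≥0) := by
    refine (hx.eventually_lt_const (ENNReal.lt_add_right hV one_ne_zero)).mono fun k hk => ?_
    simpa [ENNReal.coe_toNNReal hV] using hk.le
  rw [tendsto_iff_ultrafilter]
  intro U hU
  obtain ⟨μ, hμ⟩ := exists_tendsto_of_discreteEnergy_le hh hcoer hP hB U hU
  rw [← huniq μ ?_]
  · exact hμ
  by_contra hlt
  rw [not_le] at hlt
  obtain ⟨c, hVc, hc⟩ := exists_between hlt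
  have h1 := eventually_lt_discreteEnergy hh hP hU hμ hc
  have h2 := hU (hx.eventually_lt_const hVc)
  obtain ⟨k, h1, h2⟩ := (h1.and h2).exists
  exact lt_asymm h1 h2

/-- No convergence is assumed: tightness supplies a limit along every ultrafilter, and its energy is
at least the infimum. -/
lemma eventually_lt_discreteEnergy_of_le [T2Space X] {h : X × X → ℝ≥0∞}
    (hh : LowerSemicontinuous h) (hcoer : IsCoerciveKernel h)
    {x : (k : ℕ) → Fin k → X} {P : ℕ → ProbabilityMeasure X}
    (hP : ∀ᶠ k in atTop, (P k : Measure X) = normalizedCount (x k))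
    {B : ℝ≥0} (hB : ∀ᶠ k in atTop, discreteEnergy h (x k) ≤ B)
    {c : ℝ≥0∞} (hc : c < ⨅ μ : ProbabilityMeasure X, energy h (μ : Measure X)) :
    ∀ᶠ k in atTop, c < discreteEnergy h (x k) := by
  refine mem_iff_ultrafilter.2 fun U hU => ?_
  obtain ⟨μ, hμ⟩ := exists_tendsto_of_discreteEnergy_le hh hcoer hP hB U hU
  exact eventually_lt_discreteEnergy hh hP hU hμ (hc.trans_le (iInf_le _ μ))

omit [TopologicalSpace X] [TopologicalSpace.PseudoMetrizableSpace X]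
  [SecondCountableTopology X] [BorelSpace X] in
lemma exists_probabilityMeasure_eq_normalizedCount [Nonempty X] (x : (k : ℕ) → Fin k → X) :
    ∃ P : ℕ → ProbabilityMeasure X, ∀ᶠ k in atTop, (P k : Measure X) = normalizedCount (x k) := by
  have : ∀ k, ∃ P : ProbabilityMeasure X, k ≠ 0 → (P : Measure X) = normalizedCount (x k) := by
    intro k
    rcases eq_or_ne k 0 with hk | hk
    -- The counting measure of the empty configuration is zero, so index `0` gets an arbitrary
    -- value.
    · exact ⟨diracProba (Classical.arbitrary X), fun h => absurd hk h⟩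
    · exact ⟨⟨_, isProbabilityMeasure_normalizedCount hk (x k)⟩, fun _ => rfl⟩
  choose P hP using this
  exact ⟨P, (eventually_ne_atTop 0).mono hP⟩

/-- Averaging gives the upper bound. Configurations within `1 / k` of optimal are tight, which gives
the lower bound, and any limit of their counting measures is a minimizer. -/
lemma exists_tendsto_discreteEnergy_iInf [T2Space X] {h : X × X → ℝ≥0∞}
    (hh : LowerSemicontinuous h) (hcoer : IsCoerciveKernel h)
    (hV : ⨅ μ : ProbabilityMeasure X, energy h (μ : Measure X) ≠ ⊤) :
    Tendsto (fun k => ⨅ x : Fin k → X, discreteEnergy h x) atTop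
        (𝓝 (⨅ μ : ProbabilityMeasure X, energy h (μ : Measure X))) ∧
      ∃ μ : ProbabilityMeasure X,
        energy h (μ : Measure X) = ⨅ μ : ProbabilityMeasure X, energy h (μ : Measure X) := by
  set V := ⨅ μ : ProbabilityMeasure X, energy h (μ : Measure X) with hVdef
  have hne : Nonempty X := by
    by_contra hX
    rw [not_nonempty_iff] at hX
    have : IsEmpty (ProbabilityMeasure X) := ⟨fun μ => by
      have := μ.2.measure_univ
      simp [Set.univ_eq_empty_iff.2 hX] at this⟩
    exact hV (by rw [hVdef, iInf_of_empty])
  have hle : ∀ k : ℕ, 2 ≤ k → ⨅ x : Fin k → X, discreteEnergy h x ≤ V := fun k hk =>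
    le_iInf fun μ => by
      obtain ⟨x, hx⟩ := exists_discreteEnergy_le hk hh.measurable (μ : Measure X)
      exact (iInf_le _ x).trans hx
  have hex : ∀ k : ℕ, ∃ x : Fin k → X,
      2 ≤ k → discreteEnergy h x ≤ (⨅ x : Fin k → X, discreteEnergy h x) + (1 : ℝ≥0) / k := by
    intro k
    by_cases hk : 2 ≤ k
    · have : (⨅ x : Fin k → X, discreteEnergy h x) <
          (⨅ x : Fin k → X, discreteEnergy h x) + (1 : ℝ≥0) / k :=
        ENNReal.lt_add_right ((hle k hk).trans_lt hV.lt_top).ne (by simp)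
      obtain ⟨x, hx⟩ := iInf_lt_iff.1 this
      exact ⟨x, fun _ => hx.le⟩
    · exact ⟨fun _ => Classical.arbitrary X, fun h => absurd h hk⟩
  choose x hx using hex
  obtain ⟨P, hP⟩ := exists_probabilityMeasure_eq_normalizedCount x
  have hB : ∀ᶠ k in atTop, discreteEnergy h (x k) ≤ (V.toNNReal + 1 : ℝ≥0) := by
    filter_upwards [eventually_ge_atTop 2,
      (tendsto_const_div_natCast 1).eventually_lt_const one_pos] with k hk h1
    rw [ENNReal.coe_add, ENNReal.coe_toNNReal hV]
    exact (hx k hk).trans (add_le_add (hle k hk) (by simpa using h1.le))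
  have hlow := fun c (hc : c < V) => eventually_lt_discreteEnergy_of_le hh hcoer hP hB hc
  constructor
  · refine tendsto_order.2 ⟨fun c hc => ?_, fun c hc =>
      (eventually_ge_atTop 2).mono fun k hk => (hle k hk).trans_lt hc⟩
    obtain ⟨ε, hε, hcε⟩ := ENNReal.lt_iff_exists_add_pos_lt.1 hc
    filter_upwards [hlow _ hcε, eventually_ge_atTop 2,
      (tendsto_const_div_natCast 1).eventually_lt_const
        (show (0 : ℝ≥0∞) < ε by simpa using hε)] with k h1 hk h2
    by_contra hlt
    exact absurd (h1.trans_le ((hx k hk).trans (add_le_add (not_lt.1 hlt) h2.le))) (lt_irrefl _)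
  · obtain ⟨μ, hμ⟩ := exists_tendsto_of_discreteEnergy_le hh hcoer hP hB (hyperfilter ℕ)
      Nat.hyperfilter_le_atTop
    refine ⟨μ, le_antisymm ?_ (iInf_le _ μ)⟩
    refine le_of_forall_lt fun c hc => ?_
    obtain ⟨c', hcc', hc'⟩ := exists_between hc
    by_contra hV'
    obtain ⟨ε, hε, hcε⟩ := ENNReal.lt_iff_exists_add_pos_lt.1 hc'
    obtain ⟨k, h1, h2, h3⟩ := ((eventually_lt_discreteEnergy hh hP Nat.hyperfilter_le_atTop hμ
      hcε).and (Nat.hyperfilter_le_atTop ((eventually_ge_atTop 2).and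
        ((tendsto_const_div_natCast 1).eventually_lt_const
          (show (0 : ℝ≥0∞) < ε by simpa using hε))))).exists
    exact absurd (h1.trans_le ((hx k h2).trans
      (add_le_add ((hle k h2).trans ((not_lt.1 hV').trans hcc'.le)) h3.le))) (lt_irrefl _)

end Convergence

/-! ### Positive definiteness on the sphere and determination by moments -/

open ComplexConjugate BoundedContinuousFunction

noncomputable section

/-- `1 - c²`, with `c` the chordal distance of the images of two points on the Riemann sphere of
diameter `1`. -/
def sphereOverlap (z t : ℂ) : ℝ := ‖1 + z * conj t‖ ^ 2 / ((1 + ‖z‖ ^ 2) * (1 + ‖t‖ ^ 2))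

/-- Lagrange's identity for the vectors `(1, z)` and `(1, t)` of `ℂ²`. -/
lemma one_sub_sphereOverlap (z t : ℂ) :
    1 - sphereOverlap z t = ‖z - t‖ ^ 2 / ((1 + ‖z‖ ^ 2) * (1 + ‖t‖ ^ 2)) := by
  have h : (1 + ‖z‖ ^ 2) * (1 + ‖t‖ ^ 2) ≠ 0 := by positivity
  rw [sphereOverlap, eq_div_iff h, sub_mul, div_mul_cancel₀ _ h]
  simp only [Complex.sq_norm, Complex.normSq_apply, Complex.add_re, Complex.add_im,
    Complex.mul_re, Complex.mul_im, Complex.conj_re, Complex.conj_im, Complex.sub_re,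
    Complex.sub_im, Complex.one_re, Complex.one_im]
  ring

lemma sphereOverlap_nonneg (z t : ℂ) : 0 ≤ sphereOverlap z t := by
  unfold sphereOverlap; positivity

lemma sphereOverlap_le_one (z t : ℂ) : sphereOverlap z t ≤ 1 := by
  have h := one_sub_sphereOverlap z t
  have : 0 ≤ ‖z - t‖ ^ 2 / ((1 + ‖z‖ ^ 2) * (1 + ‖t‖ ^ 2)) := by positivity
  linarith

lemma sphereOverlap_comm (z t : ℂ) : sphereOverlap z t = sphereOverlap t z := by
  have h := one_sub_sphereOverlap z t
  rw [norm_sub_rev, mul_comm, ← one_sub_sphereOverlap] at h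
  linarith

lemma continuous_sphereOverlap : Continuous fun p : ℂ × ℂ => sphereOverlap p.1 p.2 := by
  unfold sphereOverlap
  refine Continuous.div (by fun_prop) (by fun_prop) fun p => by positivity

/-- The functions spanning the polynomials on the Riemann sphere in the planar coordinate. -/
def sphereMonomial (n j l : ℕ) (z : ℂ) : ℂ := z ^ j * conj z ^ l / (1 + ‖z‖ ^ 2 : ℝ) ^ n

lemma one_add_norm_sq_cast_ne_zero (z : ℂ) : ((1 + ‖z‖ ^ 2 : ℝ) : ℂ) ≠ 0 := by
  have : (0 : ℝ) < 1 + ‖z‖ ^ 2 := by positivity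
  exact_mod_cast this.ne'

lemma continuous_sphereMonomial (n j l : ℕ) : Continuous (sphereMonomial n j l) := by
  unfold sphereMonomial
  refine Continuous.div (by fun_prop) (by fun_prop) fun z =>
    pow_ne_zero _ (one_add_norm_sq_cast_ne_zero z)

lemma norm_sphereMonomial_le_one {n j l : ℕ} (hj : j ≤ n) (hl : l ≤ n) (z : ℂ) :
    ‖sphereMonomial n j l z‖ ≤ 1 := by
  have hs : 1 ≤ √(1 + ‖z‖ ^ 2) := Real.one_le_sqrt.2 (by nlinarith [sq_nonneg ‖z‖])
  have hz : ‖z‖ ≤ √(1 + ‖z‖ ^ 2) := Real.le_sqrt_of_sq_le (by linarith)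
  have key : ∀ i ≤ n, ‖z‖ ^ i ≤ √(1 + ‖z‖ ^ 2) ^ n := fun i hi =>
    (pow_le_pow_left₀ (norm_nonneg z) hz i).trans (pow_le_pow_right₀ hs hi)
  have hpos : 0 < (1 + ‖z‖ ^ 2) ^ n := by positivity
  rw [sphereMonomial, norm_div, norm_mul, norm_pow, norm_pow, norm_pow, Complex.norm_real,
    RCLike.norm_conj, Real.norm_of_nonneg (by positivity), div_le_one hpos]
  calc ‖z‖ ^ j * ‖z‖ ^ l ≤ √(1 + ‖z‖ ^ 2) ^ n * √(1 + ‖z‖ ^ 2) ^ n :=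
        mul_le_mul (key j hj) (key l hl) (by positivity) (by positivity)
    _ = (1 + ‖z‖ ^ 2) ^ n := by rw [← mul_pow, Real.mul_self_sqrt (by positivity)]

/-- Expanding `(1 + z t̄)^n (1 + z̄ t)^n` binomially exhibits the power as a Gram kernel with
positive coefficients, the source of positive definiteness. -/
lemma sphereOverlap_pow_eq_sum (n : ℕ) (z t : ℂ) :
    ((sphereOverlap z t ^ n : ℝ) : ℂ) =
      ∑ j ∈ Finset.range (n + 1), ∑ l ∈ Finset.range (n + 1), ((n.choose j * n.choose l : ℝ) : ℂ) *
        (sphereMonomial n j l z * conj (sphereMonomial n j l t)) := by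
  have h1 : ((‖1 + z * conj t‖ ^ 2 : ℝ) : ℂ) ^ n = (1 + z * conj t) ^ n * (1 + conj z * t) ^ n := by
    rw [← mul_pow]
    congr 1
    rw [Complex.sq_norm, Complex.normSq_eq_conj_mul_self, mul_comm]
    simp
  have h2 : ∀ a : ℂ, (1 + a) ^ n = ∑ j ∈ Finset.range (n + 1), (n.choose j : ℂ) * a ^ j := by
    intro a
    rw [add_comm, add_pow]
    exact Finset.sum_congr rfl fun j _ => by simp [mul_comm]
  have hz := pow_ne_zero n (one_add_norm_sq_cast_ne_zero z)
  have ht := pow_ne_zero n (one_add_norm_sq_cast_ne_zero t)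
  rw [sphereOverlap, div_pow, Complex.ofReal_div, Complex.ofReal_pow, h1, h2, h2,
    Finset.sum_mul_sum, Finset.sum_div]
  refine Finset.sum_congr rfl fun j _ => ?_
  rw [Finset.sum_div]
  refine Finset.sum_congr rfl fun l _ => ?_
  simp only [sphereMonomial, map_div₀, map_mul, map_pow, Complex.conj_conj, Complex.conj_ofReal,
    Complex.ofReal_pow, Complex.ofReal_mul, Complex.ofReal_natCast, mul_pow]
  field_simp

section Moments

variable {K : Set ℂ}

/-- The moments of a measure against the sphere monomials. -/
def sphereMoment (n j l : ℕ) (μ : Measure K) : ℂ := ∫ z : K, sphereMonomial n j l z ∂μ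

lemma integrable_sphereMonomial {n j l : ℕ} (hj : j ≤ n) (hl : l ≤ n) (μ : Measure K)
    [IsFiniteMeasure μ] : Integrable (fun z : K => sphereMonomial n j l z) μ :=
  Integrable.of_bound
    ((continuous_sphereMonomial n j l).comp continuous_subtype_val).aestronglyMeasurable 1
    (.of_forall fun z => norm_sphereMonomial_le_one hj hl z)

/-- The integral of a power of the sphere overlap against a product measure. -/
def overlapEnergy (n : ℕ) (μ ν : Measure K) : ℝ :=
  ∫ p : K × K, sphereOverlap p.1 p.2 ^ n ∂μ.prod ν

lemma overlapEnergy_eq_sum (n : ℕ) (μ ν : Measure K) [IsFiniteMeasure μ] [IsFiniteMeasure ν] :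
    (overlapEnergy n μ ν : ℂ) =
      ∑ j ∈ Finset.range (n + 1), ∑ l ∈ Finset.range (n + 1), ((n.choose j * n.choose l : ℝ) : ℂ) *
        (sphereMoment n j l μ * conj (sphereMoment n j l ν)) := by
  have hint : ∀ j ∈ Finset.range (n + 1), ∀ l ∈ Finset.range (n + 1),
      Integrable (fun p : K × K => ((n.choose j * n.choose l : ℝ) : ℂ) *
        (sphereMonomial n j l p.1 * conj (sphereMonomial n j l p.2))) (μ.prod ν) := by
    intro j hj l hl
    rw [Finset.mem_range, Nat.lt_succ_iff] at hj hl
    refine Integrable.const_mul (Integrable.mul_prod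
      (f := fun z : K => sphereMonomial n j l z) (g := fun z : K => conj (sphereMonomial n j l z))
      (integrable_sphereMonomial hj hl μ) ?_) _
    exact (LinearIsometryEquiv.integrable_comp_iff Complex.conjLIE).2
      (integrable_sphereMonomial hj hl ν)
  rw [overlapEnergy, ← integral_complex_ofReal]
  simp_rw [sphereOverlap_pow_eq_sum]
  rw [integral_finsetSum _ fun j hj => integrable_finsetSum _ fun l hl => hint j hj l hl]
  refine Finset.sum_congr rfl fun j hj => ?_
  rw [integral_finsetSum _ fun l hl => hint j hj l hl]
  refine Finset.sum_congr rfl fun l hl => ?_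
  rw [integral_const_mul, integral_prod_mul (fun z : K => sphereMonomial n j l z)
    fun z : K => conj (sphereMonomial n j l z), integral_conj]
  rfl

lemma overlapEnergy_polarization (n : ℕ) (μ ν : Measure K) [IsFiniteMeasure μ]
    [IsFiniteMeasure ν] :
    overlapEnergy n μ μ + overlapEnergy n ν ν - (overlapEnergy n μ ν + overlapEnergy n ν μ) =
      ∑ j ∈ Finset.range (n + 1), ∑ l ∈ Finset.range (n + 1), (n.choose j * n.choose l : ℝ) *
        ‖sphereMoment n j l μ - sphereMoment n j l ν‖ ^ 2 := by
  apply Complex.ofReal_injective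
  push_cast [overlapEnergy_eq_sum]
  simp only [← Finset.sum_add_distrib, ← Finset.sum_sub_distrib]
  refine Finset.sum_congr rfl fun j _ => Finset.sum_congr rfl fun l _ => ?_
  rw [← Complex.ofReal_pow, Complex.sq_norm, Complex.normSq_eq_conj_mul_self, map_sub]
  ring

lemma overlapEnergy_add_le (n : ℕ) (μ ν : Measure K) [IsFiniteMeasure μ] [IsFiniteMeasure ν] :
    overlapEnergy n μ ν + overlapEnergy n ν μ ≤ overlapEnergy n μ μ + overlapEnergy n ν ν := by
  rw [← sub_nonneg, overlapEnergy_polarization]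
  positivity

/-- The hypothesis makes the sum of squares in `overlapEnergy_polarization` vanish, and its
coefficients are nonzero. -/
lemma sphereMoment_eq {n : ℕ} {μ ν : Measure K} [IsFiniteMeasure μ] [IsFiniteMeasure ν]
    (h : overlapEnergy n μ μ + overlapEnergy n ν ν ≤ overlapEnergy n μ ν + overlapEnergy n ν μ)
    {j l : ℕ} (hj : j ≤ n) (hl : l ≤ n) : sphereMoment n j l μ = sphereMoment n j l ν := by
  have h0 := overlapEnergy_polarization n μ ν
  rw [sub_eq_zero.2 (le_antisymm h (overlapEnergy_add_le n μ ν)), eq_comm,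
    Finset.sum_eq_zero_iff_of_nonneg fun _ _ => by positivity] at h0
  have h1 := h0 j (Finset.mem_range.2 (Nat.lt_succ_of_le hj))
  rw [Finset.sum_eq_zero_iff_of_nonneg fun _ _ => by positivity] at h1
  have h2 := h1 l (Finset.mem_range.2 (Nat.lt_succ_of_le hl))
  have hc : (n.choose j * n.choose l : ℝ) ≠ 0 := by
    have := Nat.choose_pos hj
    have := Nat.choose_pos hl
    positivity
  simpa [hc, sub_eq_zero] using h2

/-- The bounded continuous functions given by a sphere monomial. -/
def sphereMonomials (K : Set ℂ) : Submonoid (K →ᵇ ℂ) where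
  carrier := {g | ∃ n j l, j ≤ n ∧ l ≤ n ∧ ∀ z : K, g z = sphereMonomial n j l z}
  one_mem' := ⟨0, 0, 0, le_rfl, le_rfl, fun z => by simp [sphereMonomial]⟩
  mul_mem' := by
    rintro g g' ⟨n, j, l, hj, hl, hg⟩ ⟨n', j', l', hj', hl', hg'⟩
    refine ⟨n + n', j + j', l + l', by omega, by omega, fun z => ?_⟩
    have := one_add_norm_sq_cast_ne_zero z
    rw [BoundedContinuousFunction.mul_apply, hg, hg']
    simp only [sphereMonomial]
    field_simp
    ring

lemma exists_mem_sphereMonomials (K : Set ℂ) {n j l : ℕ} (hj : j ≤ n) (hl : l ≤ n) :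
    ∃ g ∈ sphereMonomials K, ∀ z : K, g z = sphereMonomial n j l z :=
  ⟨BoundedContinuousFunction.ofNormedAddCommGroup (fun z : K => sphereMonomial n j l z)
    ((continuous_sphereMonomial n j l).comp continuous_subtype_val) 1
    fun z => norm_sphereMonomial_le_one hj hl z, ⟨n, j, l, hj, hl, fun _ => rfl⟩, fun _ => rfl⟩

/-- The star algebra of polynomial functions on the Riemann sphere. -/
def spherePolynomials (K : Set ℂ) : StarSubalgebra ℂ (K →ᵇ ℂ) where
  toSubalgebra := Algebra.adjoin ℂ (sphereMonomials K)
  star_mem' := by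
    intro g hg
    change star g ∈ Algebra.adjoin ℂ (sphereMonomials K : Set (K →ᵇ ℂ))
    change g ∈ Algebra.adjoin ℂ (sphereMonomials K : Set (K →ᵇ ℂ)) at hg
    induction hg using Algebra.adjoin_induction with
    | mem g hg =>
      obtain ⟨n, j, l, hj, hl, hg⟩ := hg
      refine Algebra.subset_adjoin ⟨n, l, j, hl, hj, fun z => ?_⟩
      simp [hg, sphereMonomial, mul_comm]
    | algebraMap r =>
      rw [← algebraMap_star_comm]
      exact Subalgebra.algebraMap_mem _ _
    | add f g _ _ hf hg => rw [star_add]; exact add_mem hf hg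
    | mul f g _ _ hf hg => rw [star_mul]; exact mul_mem hg hf

lemma separatesPoints_spherePolynomials (K : Set ℂ) :
    ((spherePolynomials K).map (toContinuousMapStarₐ ℂ)).SeparatesPoints := by
  intro z w hzw
  by_contra hcon
  push Not at hcon
  -- The functions `1 / (1 + |z|²)` and `z / (1 + |z|²)` already separate points: their quotient is
  -- `z`.
  have key : ∀ j ≤ 1, sphereMonomial 1 j 0 z = sphereMonomial 1 j 0 w := by
    intro j hj
    obtain ⟨g, hg, hgz⟩ := exists_mem_sphereMonomials K hj (Nat.zero_le 1)
    rw [← hgz, ← hgz]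
    exact hcon g ⟨g.toContinuousMap, ⟨g, Algebra.subset_adjoin hg, rfl⟩, rfl⟩
  have h0 := key 0 zero_le_one
  have h1 := key 1 le_rfl
  have hz := one_add_norm_sq_cast_ne_zero z
  have hw := one_add_norm_sq_cast_ne_zero w
  simp only [sphereMonomial, pow_zero, pow_one, mul_one, one_div, inv_inj] at h0 h1
  rw [h0, div_left_inj' hw] at h1
  exact hzw (Subtype.ext h1)

/-- Sphere monomials are closed under products, so the algebra they generate is their linear span.
Equal moments thus give equal integrals over a point-separating star algebra of bounded functions.
-/
lemma eq_of_sphereMoment_eq [PolishSpace K] {μ ν : Measure K} [IsFiniteMeasure μ]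
    [IsFiniteMeasure ν]
    (h : ∀ n j l, j ≤ n → l ≤ n → sphereMoment n j l μ = sphereMoment n j l ν) : μ = ν := by
  refine ext_of_forall_mem_subalgebra_integral_eq_of_polish
    (separatesPoints_spherePolynomials K) fun g hg => ?_
  have hg' : g ∈ Subalgebra.toSubmodule (Algebra.adjoin ℂ (sphereMonomials K : Set (K →ᵇ ℂ))) := hg
  rw [Algebra.adjoin_eq_span, Submonoid.closure_eq] at hg'
  clear hg
  induction hg' using Submodule.span_induction with
  | mem g hg =>
    obtain ⟨n, j, l, hj, hl, hg⟩ := hg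
    simp_rw [hg]
    exact h n j l hj hl
  | zero => simp
  | add f g _ _ hf hg =>
    simp only [BoundedContinuousFunction.add_apply]
    rw [integral_add (f.integrable μ) (g.integrable μ),
      integral_add (f.integrable ν) (g.integrable ν)]
    rw [hf, hg]
  | smul c f _ hf =>
    simp only [BoundedContinuousFunction.smul_apply]
    rw [integral_smul, integral_smul, hf]

end Moments

end

/-! ### The chordal logarithmic kernel and its energy -/

noncomputable section

/-- The logarithmic kernel `log (1 / c)` of the chordal distance `c`, as a power series in
`1 - c²`. -/
def chordalKernel (z t : ℂ) : ℝ≥0∞ :=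
  ∑' n : ℕ, ENNReal.ofReal (1 / (2 * (n + 1))) * ENNReal.ofReal (sphereOverlap z t ^ (n + 1))

/-- The logarithm of the conformal factor of the stereographic projection. -/
def sphereWeight (z : ℂ) : ℝ := Real.log (1 + ‖z‖ ^ 2) / 2

lemma continuous_sphereWeight : Continuous sphereWeight := by
  unfold sphereWeight
  exact (Continuous.log (by fun_prop) fun z => by positivity).div_const _

lemma continuous_overlap_term (n : ℕ) : Continuous fun p : ℂ × ℂ =>
    ENNReal.ofReal (1 / (2 * (n + 1))) * ENNReal.ofReal (sphereOverlap p.1 p.2 ^ (n + 1)) :=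
  (ENNReal.continuous_const_mul ENNReal.ofReal_ne_top).comp
    (ENNReal.continuous_ofReal.comp (continuous_sphereOverlap.pow _))

lemma lowerSemicontinuous_chordalKernel :
    LowerSemicontinuous fun p : ℂ × ℂ => chordalKernel p.1 p.2 :=
  lowerSemicontinuous_tsum fun n => (continuous_overlap_term n).lowerSemicontinuous

lemma chordalKernel_comm (z t : ℂ) : chordalKernel z t = chordalKernel t z := by
  simp_rw [chordalKernel, sphereOverlap_comm z t]

/-- At overlap `1` the series is half the harmonic series. -/
lemma chordalKernel_self (z : ℂ) : chordalKernel z z = ⊤ := by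
  have h1 : sphereOverlap z z = 1 := by
    have := one_sub_sphereOverlap z z
    simp only [sub_self, norm_zero, ne_eq, OfNat.ofNat_ne_zero, not_false_eq_true, zero_pow,
      zero_div] at this
    linarith
  by_contra hne
  simp only [chordalKernel, h1, one_pow, ENNReal.ofReal_one, mul_one] at hne
  have hs := ENNReal.summable_toReal hne
  have hs' : Summable fun n : ℕ => (1 : ℝ) / ((n + 1 : ℕ) : ℝ) := by
    refine (hs.mul_left 2).congr fun n => ?_
    rw [ENNReal.toReal_ofReal (by positivity)]
    push_cast
    field_simp
  exact Real.not_summable_one_div_natCast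
    ((summable_nat_add_iff (f := fun n : ℕ => (1 : ℝ) / (n : ℝ)) 1).1 hs')

lemma sphereOverlap_lt_one {z t : ℂ} (h : z ≠ t) : sphereOverlap z t < 1 := by
  have h1 := one_sub_sphereOverlap z t
  have : 0 < ‖z - t‖ := norm_pos_iff.2 (sub_ne_zero.2 h)
  have : 0 < ‖z - t‖ ^ 2 / ((1 + ‖z‖ ^ 2) * (1 + ‖t‖ ^ 2)) := by positivity
  linarith

/-- The series of `-log (1 - s)`. The series form also yields lower semicontinuity and, term by
term, positive definiteness. -/
lemma chordalKernel_eq_log {z t : ℂ} (h : z ≠ t) :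
    chordalKernel z t = ENNReal.ofReal (-Real.log (1 - sphereOverlap z t) / 2) := by
  have h0 := sphereOverlap_nonneg z t
  have hs := (Real.hasSum_pow_div_log_of_abs_lt_one
    (abs_lt.2 ⟨by linarith, sphereOverlap_lt_one h⟩)).div_const 2
  rw [← hs.tsum_eq, ENNReal.ofReal_tsum_of_nonneg (fun n => by positivity) hs.summable]
  refine tsum_congr fun n => ?_
  rw [← ENNReal.ofReal_mul (by positivity)]
  congr 1
  field_simp

lemma neg_log_one_sub_sphereOverlap {z t : ℂ} (h : z ≠ t) :
    -Real.log (1 - sphereOverlap z t) / 2 =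
      sphereWeight z + sphereWeight t - Real.log ‖z - t‖ := by
  have : ‖z - t‖ ≠ 0 := norm_ne_zero_iff.2 (sub_ne_zero.2 h)
  rw [one_sub_sphereOverlap, Real.log_div (by positivity) (by positivity),
    Real.log_mul (by positivity) (by positivity), Real.log_pow]
  simp only [sphereWeight]
  push_cast
  ring

lemma neg_log_one_sub_sphereOverlap_nonneg (z t : ℂ) :
    0 ≤ -Real.log (1 - sphereOverlap z t) / 2 := by
  have := Real.log_nonpos (sub_nonneg.2 (sphereOverlap_le_one z t))
    (by linarith [sphereOverlap_nonneg z t])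
  linarith

/-- Both points are near the pole, hence near each other: `|z - t|² ≤ 2|z|² + 2|t|²` bounds the
squared chordal distance by two terms, each at most `e^{-2N} / 2` at radius `2 e^N`. -/
lemma le_chordalKernel_of_le_norm {N : ℝ} {z t : ℂ} (hz : 2 * Real.exp N ≤ ‖z‖)
    (ht : 2 * Real.exp N ≤ ‖t‖) : ENNReal.ofReal N ≤ chordalKernel z t := by
  rcases eq_or_ne z t with rfl | h
  · simp [chordalKernel_self]
  rw [chordalKernel_eq_log h]
  refine ENNReal.ofReal_le_ofReal ?_
  have hpos : 0 < 1 - sphereOverlap z t := sub_pos.2 (sphereOverlap_lt_one h)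
  have hE := Real.exp_pos N
  have hsum : 1 - sphereOverlap z t ≤ 2 / (1 + ‖z‖ ^ 2) + 2 / (1 + ‖t‖ ^ 2) := by
    rw [one_sub_sphereOverlap, div_add_div _ _ (by positivity) (by positivity)]
    gcongr
    have := norm_sub_le z t
    nlinarith [sq_nonneg (‖z‖ - ‖t‖), norm_nonneg (z - t), norm_nonneg z, norm_nonneg t]
  have hbd : ∀ s : ℂ, 2 * Real.exp N ≤ ‖s‖ → 2 / (1 + ‖s‖ ^ 2) ≤ Real.exp (-(2 * N)) / 2 := by
    intro s hs
    have : Real.exp (-(2 * N)) = 1 / (Real.exp N * Real.exp N) := by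
      rw [Real.exp_neg, two_mul, Real.exp_add, one_div]
    rw [this, div_le_iff₀ (by positivity)]
    have h4 : 4 * (Real.exp N * Real.exp N) ≤ 1 + ‖s‖ ^ 2 := by nlinarith
    calc (2 : ℝ) = 1 / (Real.exp N * Real.exp N) / 2 * (4 * (Real.exp N * Real.exp N)) := by
          field_simp; norm_num
      _ ≤ _ := by gcongr
  have hle : 1 - sphereOverlap z t ≤ Real.exp (-(2 * N)) := by
    linarith [hbd z hz, hbd t ht]
  have := Real.log_le_log hpos hle
  rw [Real.log_exp] at this
  linarith

section MutualEnergy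

variable {K : Set ℂ}

/-- The mutual chordal energy of two measures. -/
def chordalEnergy (μ ν : Measure K) : ℝ≥0∞ := ∫⁻ p : K × K, chordalKernel p.1 p.2 ∂μ.prod ν

lemma continuous_coe_prod : Continuous fun p : K × K => ((p.1 : ℂ), (p.2 : ℂ)) := by fun_prop

lemma measurable_chordalKernel : Measurable fun p : K × K => chordalKernel p.1 p.2 := by
  have h : LowerSemicontinuous fun p : K × K => chordalKernel p.1 p.2 :=
    (lowerSemicontinuous_chordalKernel.comp continuous_coe_prod :)
  exact h.measurable

lemma chordalEnergy_eq_tsum (μ ν : Measure K) [IsFiniteMeasure μ] [IsFiniteMeasure ν] :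
    chordalEnergy μ ν = ∑' n : ℕ,
      ENNReal.ofReal (1 / (2 * (n + 1))) * ENNReal.ofReal (overlapEnergy (n + 1) μ ν) := by
  have hc : Continuous fun p : K × K => sphereOverlap p.1 p.2 :=
    (continuous_sphereOverlap.comp continuous_coe_prod :)
  have hm : ∀ n : ℕ, Measurable fun p : K × K =>
      ENNReal.ofReal (sphereOverlap p.1 p.2 ^ (n + 1)) := fun n =>
    (hc.measurable.pow_const (n + 1)).ennreal_ofReal
  unfold chordalEnergy chordalKernel
  rw [lintegral_tsum fun n => ((hm n).const_mul _).aemeasurable]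
  refine tsum_congr fun n => ?_
  rw [lintegral_const_mul _ (hm n), overlapEnergy, ← ofReal_integral_eq_lintegral_ofReal]
  · refine Integrable.of_bound (hc.pow _).aestronglyMeasurable 1 (.of_forall fun p => ?_)
    rw [Real.norm_of_nonneg (pow_nonneg (sphereOverlap_nonneg _ _) _)]
    exact pow_le_one₀ (sphereOverlap_nonneg _ _) (sphereOverlap_le_one _ _)
  · exact .of_forall fun p => pow_nonneg (sphereOverlap_nonneg _ _) _

lemma overlapEnergy_nonneg (n : ℕ) (μ ν : Measure K) : 0 ≤ overlapEnergy n μ ν :=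
  integral_nonneg fun _ => pow_nonneg (sphereOverlap_nonneg _ _) _

/-- Strict positive definiteness of the chordal kernel. -/
lemma eq_of_chordalEnergy_le [PolishSpace K] {μ ν : Measure K} [IsProbabilityMeasure μ]
    [IsProbabilityMeasure ν] (hfin : chordalEnergy μ μ + chordalEnergy ν ν ≠ ⊤)
    (hle : chordalEnergy μ μ + chordalEnergy ν ν ≤ chordalEnergy μ ν + chordalEnergy ν μ) :
    μ = ν := by
  simp only [chordalEnergy_eq_tsum, ← ENNReal.tsum_add, ← mul_add,
    ← ENNReal.ofReal_add (overlapEnergy_nonneg _ _ _) (overlapEnergy_nonneg _ _ _)] at hfin hle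
  refine eq_of_sphereMoment_eq fun n j l hj hl => ?_
  rcases n with _ | n
  -- The series has no constant term; the moment of order `0` is the total mass, equal for
  -- probability measures.
  · obtain rfl : j = 0 := by omega
    obtain rfl : l = 0 := by omega
    simp [sphereMoment, sphereMonomial]
  refine sphereMoment_eq ?_ hj hl
  by_contra hlt
  rw [not_le] at hlt
  have hterm : ∀ m : ℕ, ENNReal.ofReal (1 / (2 * (m + 1))) *
        ENNReal.ofReal (overlapEnergy (m + 1) μ ν + overlapEnergy (m + 1) ν μ) ≤
      ENNReal.ofReal (1 / (2 * (m + 1))) *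
        ENNReal.ofReal (overlapEnergy (m + 1) μ μ + overlapEnergy (m + 1) ν ν) := fun m =>
    mul_le_mul_right (ENNReal.ofReal_le_ofReal (overlapEnergy_add_le (m + 1) μ ν)) _
  -- The inequality holds termwise in the opposite direction, so strictness in one term contradicts
  -- `hle` once the sums are finite.
  refine absurd hle (not_le.2 (ENNReal.tsum_lt_tsum (i := n) (ne_top_of_le_ne_top hfin ?_) ?_ ?_))
  · exact ENNReal.tsum_le_tsum hterm
  · exact hterm
  · refine (ENNReal.mul_lt_mul_iff_right ?_ ENNReal.ofReal_ne_top).2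
      ((ENNReal.ofReal_lt_ofReal_iff_of_nonneg ?_).2 hlt)
    · rw [ne_eq, ENNReal.ofReal_eq_zero, not_le]
      positivity
    · exact add_nonneg (overlapEnergy_nonneg _ _ _) (overlapEnergy_nonneg _ _ _)

end MutualEnergy

/-! ### The weighted kernel on the sphere -/

section WeightedKernel

variable {K : Set ℂ} {Q : K → EReal}

/-- The external field on the sphere, shifted by a constant. -/
def sphereField (Q : K → EReal) (c : ℝ) (z : K) : ℝ≥0∞ :=
  (Q z + ((c - sphereWeight z : ℝ) : EReal)).toENNReal

/-- The weighted kernel on the sphere, shifted by a constant. -/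
def weightedKernel (Q : K → EReal) (c : ℝ) (p : K × K) : ℝ≥0∞ :=
  chordalKernel p.1 p.2 + (sphereField Q c p.1 + sphereField Q c p.2)

lemma sphereField_eq_top {c : ℝ} {z : K} (hz : Q z = ⊤) : sphereField Q c z = ⊤ := by
  rw [sphereField, hz, EReal.top_add_coe, EReal.toENNReal_top]

lemma weightedKernel_swap (Q : K → EReal) (c : ℝ) (z t : K) :
    weightedKernel Q c (z, t) = weightedKernel Q c (t, z) := by
  simp only [weightedKernel]
  rw [chordalKernel_comm, add_comm (sphereField Q c z)]

lemma lowerSemicontinuous_sphereField (hQ : LowerSemicontinuous Q) (c : ℝ) :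
    LowerSemicontinuous (sphereField Q c) := by
  refine EReal.continuous_toENNReal.comp_lowerSemicontinuous ?_
    fun _ _ h => EReal.toENNReal_le_toENNReal h
  refine hQ.add' (Continuous.lowerSemicontinuous ?_) fun z =>
    EReal.continuousAt_add (.inr (EReal.coe_ne_bot _)) (.inr (EReal.coe_ne_top _))
  exact continuous_coe_real_ereal.comp
    (continuous_const.sub (continuous_sphereWeight.comp continuous_subtype_val))

lemma lowerSemicontinuous_weightedKernel (hQ : LowerSemicontinuous Q) (c : ℝ) :
    LowerSemicontinuous (weightedKernel Q c) :=
  (lowerSemicontinuous_chordalKernel.comp continuous_coe_prod).add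
    (((lowerSemicontinuous_sphereField hQ c).comp continuous_fst).add
      ((lowerSemicontinuous_sphereField hQ c).comp continuous_snd))

lemma isCoerciveKernel_weightedKernel (hK : IsClosed K) (Q : K → EReal) (c : ℝ) :
    IsCoerciveKernel (weightedKernel Q c) := by
  intro N
  refine ⟨Subtype.val ⁻¹' Metric.closedBall 0 (2 * Real.exp N),
    hK.isClosedEmbedding_subtypeVal.isCompact_preimage (isCompact_closedBall _ _),
    fun x hx y hy => ?_⟩
  simp only [Set.mem_preimage, mem_closedBall_zero_iff, not_le] at hx hy
  refine le_trans ?_ le_self_add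
  simpa using le_chordalKernel_of_le_norm hx.le hy.le

/-- `Q` exceeds the logarithm of the conformal factor, up to a constant. -/
def IsSphereBound (Q : K → EReal) (c : ℝ) : Prop :=
  ∀ z, 0 ≤ Q z + ((c - sphereWeight z : ℝ) : EReal)

lemma IsSphereBound.ne_bot {c : ℝ} (h : IsSphereBound Q c) (z : K) : Q z ≠ ⊥ := by
  intro hz
  have := h z
  simp [hz] at this

/-- The conformal factors in the chordal distance cancel against those in the fields.
`IsSphereBound` ensures that `toENNReal` truncates nothing. On the diagonal, or where `Q` is
infinite, both sides are zero. -/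
lemma weight_product_eq {c : ℝ} (h : IsSphereBound Q c) (z t : K) :
    edist z t * weight Q z * weight Q t =
      EReal.exp ((2 * c : ℝ) : EReal) * EReal.exp (-(weightedKernel Q c (z, t) : EReal)) := by
  rcases eq_or_ne z t with rfl | hne
  · simp [weightedKernel, chordalKernel_self]
  have hne' : (z : ℂ) ≠ t := fun h => hne (Subtype.ext h)
  rcases eq_or_ne (Q z) ⊤ with hz | hz
  · simp [weight, weightedKernel, sphereField_eq_top hz, hz]
  rcases eq_or_ne (Q t) ⊤ with ht | ht
  · simp [weight, weightedKernel, sphereField_eq_top ht, ht]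
  have hbz := h z
  have hbt := h t
  obtain ⟨a, ha⟩ : ∃ a : ℝ, Q z = a := ⟨_, (EReal.coe_toReal hz (h.ne_bot z)).symm⟩
  obtain ⟨b, hb⟩ : ∃ b : ℝ, Q t = b := ⟨_, (EReal.coe_toReal ht (h.ne_bot t)).symm⟩
  rw [ha, ← EReal.coe_add, EReal.coe_nonneg] at hbz
  rw [hb, ← EReal.coe_add, EReal.coe_nonneg] at hbt
  have hg := neg_log_one_sub_sphereOverlap_nonneg z t
  have hpos : 0 < ‖(z : ℂ) - t‖ := norm_pos_iff.2 (sub_ne_zero.2 hne')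
  have hk : weightedKernel Q c (z, t) =
      ENNReal.ofReal (2 * c + a + b - Real.log ‖(z : ℂ) - t‖) := by
    simp only [weightedKernel, sphereField, ha, hb, ← EReal.coe_add, EReal.real_coe_toENNReal]
    rw [chordalKernel_eq_log hne', ← ENNReal.ofReal_add hbz hbt,
      ← ENNReal.ofReal_add hg (add_nonneg hbz hbt), neg_log_one_sub_sphereOverlap hne']
    congr 1
    ring
  have hk0 : 0 ≤ 2 * c + a + b - Real.log ‖(z : ℂ) - t‖ := by
    rw [neg_log_one_sub_sphereOverlap hne'] at hg
    linarith
  rw [hk, EReal.coe_ennreal_ofReal, max_eq_left hk0, ← EReal.coe_neg, EReal.exp_coe,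
    EReal.exp_coe, weight, weight, ha, hb, ← EReal.coe_neg, ← EReal.coe_neg, EReal.exp_coe,
    EReal.exp_coe, Subtype.edist_eq, edist_dist, dist_eq_norm,
    ← ENNReal.ofReal_mul (by positivity), ← ENNReal.ofReal_mul (by positivity),
    ← ENNReal.ofReal_mul (by positivity)]
  congr 1
  rw [← Real.exp_add]
  nth_rw 1 [← Real.exp_log hpos]
  rw [← Real.exp_add, ← Real.exp_add]
  congr 1
  ring

lemma log_inv_weight_product_eq {c : ℝ} (h : IsSphereBound Q c) (z t : K) :
    ENNReal.log (edist z t * weight Q z * weight Q t)⁻¹ =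
      (weightedKernel Q c (z, t) : EReal) - ((2 * c : ℝ) : EReal) := by
  rw [weight_product_eq h, ENNReal.log_inv, ENNReal.log_mul_add, EReal.log_exp, EReal.log_exp,
    EReal.neg_add (.inl (EReal.coe_ne_bot _)) (.inl (EReal.coe_ne_top _)), sub_eq_add_neg,
    neg_neg, add_comm, sub_eq_add_neg]

end WeightedKernel

end

/-! ### Translation of weighted energies and Vandermondes to the sphere -/

noncomputable section

section Translation

variable {K : Set ℂ} {Q : K → EReal}

lemma sphereWeight_le_of_norm_le {z : ℂ} {R : ℝ} (hz : ‖z‖ ≤ R) :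
    sphereWeight z ≤ Real.log (1 + R ^ 2) / 2 := by
  unfold sphereWeight
  gcongr

lemma sphereWeight_le_log_norm {z : ℂ} (hz : 1 ≤ ‖z‖) :
    sphereWeight z ≤ Real.log ‖z‖ + Real.log 2 / 2 := by
  have h : Real.log (1 + ‖z‖ ^ 2) ≤ Real.log (2 * ‖z‖ ^ 2) :=
    Real.log_le_log (by positivity) (by nlinarith)
  rw [Real.log_mul (by norm_num) (by positivity), Real.log_pow] at h
  push_cast at h
  unfold sphereWeight
  linarith

lemma exists_real_le_of_isCompact {α : Type*} [TopologicalSpace α] {f : α → EReal} {s : Set α}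
    (hs : IsCompact s) (hf : LowerSemicontinuous f) (hbot : ∀ a, f a ≠ ⊥) :
    ∃ m : ℝ, ∀ a ∈ s, (m : EReal) ≤ f a := by
  rcases s.eq_empty_or_nonempty with rfl | hne
  · exact ⟨0, by simp⟩
  obtain ⟨a, -, ha⟩ := (hf.lowerSemicontinuousOn s).exists_isMinOn hne hs
  obtain ⟨m, -, hm⟩ := EReal.lt_iff_exists_real_btwn.1 (bot_lt_iff_ne_bot.2 (hbot a))
  exact ⟨m, fun b hb => hm.le.trans (ha hb)⟩

/-- Far out, `sphereWeight` exceeds `log |z|` by at most a constant and the liminf bounds `Q - log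
|z|` below. On the remaining compact set `Q` is bounded below by semicontinuity. -/
lemma IsWeaklyAdmissible.exists_isSphereBound (hK : IsClosed K) (hQ : IsWeaklyAdmissible Q) :
    ∃ c : ℝ, 0 ≤ c ∧ IsSphereBound Q c := by
  obtain ⟨M, hM⟩ := hQ.liminf_eq
  have hev := eventually_lt_of_lt_liminf
    (hM.symm ▸ (EReal.coe_lt_coe_iff.2 (sub_one_lt M)) :
      ((M - 1 : ℝ) : EReal) < liminf (fun z : K => Q z - ((Real.log ‖(z : ℂ)‖ : ℝ) : EReal))
        (comap (fun z : K => ‖(z : ℂ)‖) atTop))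
  rw [eventually_comap] at hev
  obtain ⟨R, hR⟩ := eventually_atTop.1 hev
  obtain ⟨m, hm⟩ := exists_real_le_of_isCompact
    (hK.isClosedEmbedding_subtypeVal.isCompact_preimage
      (isCompact_closedBall (0 : ℂ) (max R 1))) hQ.lowerSemicontinuous hQ.ne_bot
  -- The three entries serve the sign of `c`, the points with `|z| ≤ max R 1`, and the points
  -- beyond.
  refine ⟨max 0 (max (Real.log (1 + (max R 1) ^ 2) / 2 - m) (Real.log 2 / 2 - M + 1)),
    le_max_left _ _, fun z => ?_⟩
  set c := max 0 (max (Real.log (1 + (max R 1) ^ 2) / 2 - m) (Real.log 2 / 2 - M + 1))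
  have hc1 : Real.log (1 + (max R 1) ^ 2) / 2 - m ≤ c :=
    (le_max_left _ _).trans (le_max_right _ _)
  have hc2 : Real.log 2 / 2 - M + 1 ≤ c := (le_max_right _ _).trans (le_max_right _ _)
  rcases eq_or_ne (Q z) ⊤ with hz | hz
  · rw [hz, EReal.top_add_coe]
    exact le_top
  obtain ⟨a, ha⟩ : ∃ a : ℝ, Q z = a := ⟨_, (EReal.coe_toReal hz (hQ.ne_bot z)).symm⟩
  rw [ha, ← EReal.coe_add, EReal.coe_nonneg]
  rcases le_total ‖(z : ℂ)‖ (max R 1) with hzR | hzR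
  · have h1 := hm z (by simpa using hzR)
    rw [ha, EReal.coe_le_coe_iff] at h1
    linarith [sphereWeight_le_of_norm_le hzR]
  · have h1 := hR _ ((le_max_left R 1).trans hzR) z rfl
    rw [ha, ← EReal.coe_sub, EReal.coe_lt_coe_iff] at h1
    linarith [sphereWeight_le_log_norm ((le_max_right R 1).trans hzR)]

/-- The positive and negative parts are the truncated differences `h - c` and `c - h`. Integrating
`(h - c) + c = h + (c - h)` gives the formula, and the negative part is at most `c`, so no `∞ - ∞`
occurs. -/
lemma erealIntegral_coe_sub {α : Type*} [MeasurableSpace α] {μ : Measure α}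
    [IsProbabilityMeasure μ] {h : α → ℝ≥0∞} (hh : Measurable h) (c : ℝ≥0) :
    erealIntegral μ (fun a => (h a : EReal) - ((c : ℝ) : EReal)) =
      ((∫⁻ a, h a ∂μ : ℝ≥0∞) : EReal) - ((c : ℝ) : EReal) := by
  have h1 : ∀ a, ((h a : EReal) - ((c : ℝ) : EReal)).toENNReal = h a - c := fun a => by
    rw [EReal.toENNReal_sub (EReal.coe_nonneg.2 (NNReal.coe_nonneg c)), EReal.toENNReal_coe,
      EReal.real_coe_toENNReal, ENNReal.ofReal_coe_nnreal]
  have h2 : ∀ a, (-((h a : EReal) - ((c : ℝ) : EReal))).toENNReal = c - h a := fun a => by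
    rw [EReal.neg_sub (.inr (EReal.coe_ne_bot _)) (.inr (EReal.coe_ne_top _)), add_comm,
      ← sub_eq_add_neg, EReal.toENNReal_sub (EReal.coe_ennreal_nonneg _), EReal.toENNReal_coe,
      EReal.real_coe_toENNReal, ENNReal.ofReal_coe_nnreal]
  simp only [erealIntegral, h1, h2]
  have hN : ∫⁻ a, (c - h a) ∂μ ≤ c := by
    calc ∫⁻ a, (c - h a) ∂μ ≤ ∫⁻ _, (c : ℝ≥0∞) ∂μ := lintegral_mono fun a => tsub_le_self
      _ = c := by simp
  have hsum : ∫⁻ a, (h a - c) ∂μ + c = ∫⁻ a, h a ∂μ + ∫⁻ a, (c - h a) ∂μ := by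
    rw [← lintegral_add_left hh]
    have hc : ∫⁻ _, (c : ℝ≥0∞) ∂μ = c := by simp
    nth_rw 2 [← hc]
    rw [← lintegral_add_right _ measurable_const]
    refine lintegral_congr fun a => ?_
    rw [tsub_add_eq_max, add_tsub_eq_max]
  generalize ∫⁻ a, (h a - c) ∂μ = P at hsum ⊢
  generalize ∫⁻ a, (c - h a) ∂μ = N at hN hsum ⊢
  generalize ∫⁻ a, h a ∂μ = H at hsum ⊢
  lift N to ℝ≥0 using ne_top_of_le_ne_top ENNReal.coe_ne_top hN
  rcases eq_or_ne P ⊤ with rfl | hP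
  · obtain rfl : H = ⊤ := by
      rw [top_add, eq_comm, ENNReal.add_eq_top] at hsum
      simpa using hsum
    rw [EReal.coe_ennreal_top, EReal.coe_nnreal_eq_coe_real, EReal.top_sub_coe,
      EReal.top_sub_coe]
  · have hH : H ≠ ⊤ := by
      rintro rfl
      rw [top_add, ENNReal.add_eq_top] at hsum
      simp [hP] at hsum
    lift P to ℝ≥0 using hP
    lift H to ℝ≥0 using hH
    have h3 : (P : ℝ) + c = H + N := by exact_mod_cast hsum
    have h4 : (P : ℝ) - N = H - c := by linarith
    simp only [EReal.coe_nnreal_eq_coe_real, ← EReal.coe_sub, h4]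

lemma weightedEnergy_eq {c : ℝ} (hc : 0 ≤ c) (h : IsSphereBound Q c)
    (hQ : LowerSemicontinuous Q) (μ : ProbabilityMeasure K) :
    weightedEnergy Q μ =
      (energy (weightedKernel Q c) (μ : Measure K) : EReal) - ((2 * c : ℝ) : EReal) := by
  have := erealIntegral_coe_sub (μ := (μ : Measure K).prod (μ : Measure K))
    (lowerSemicontinuous_weightedKernel hQ c).measurable (⟨2 * c, by positivity⟩ : ℝ≥0)
  simp only [weightedEnergy, log_inv_weight_product_eq h]
  exact this

/-- The decreasing homeomorphism from energies to transfinite diameters. -/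
def expNeg (c : ℝ) (a : ℝ≥0∞) : ℝ≥0∞ := EReal.exp ((2 * c : ℝ) : EReal) * EReal.exp (-(a : EReal))

lemma exp_coe_ne_top (c : ℝ) : EReal.exp ((2 * c : ℝ) : EReal) ≠ ⊤ := by
  rw [ne_eq, EReal.exp_eq_top_iff]
  exact EReal.coe_ne_top _

lemma exp_coe_ne_zero (c : ℝ) : EReal.exp ((2 * c : ℝ) : EReal) ≠ 0 := by
  rw [ne_eq, EReal.exp_eq_zero_iff]
  exact EReal.coe_ne_bot _

lemma continuous_expNeg (c : ℝ) : Continuous (expNeg c) :=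
  (ENNReal.continuous_const_mul (exp_coe_ne_top c)).comp
    (ENNReal.continuous_exp.comp (continuous_neg.comp continuous_coe_ennreal_ereal))

lemma antitone_expNeg (c : ℝ) : Antitone (expNeg c) := by
  intro a b hab
  unfold expNeg
  gcongr
  exact EReal.neg_le_neg_iff.2 (EReal.coe_ennreal_le_coe_ennreal_iff.2 hab)

lemma expNeg_le (c : ℝ) (a : ℝ≥0∞) : expNeg c a ≤ EReal.exp ((2 * c : ℝ) : EReal) := by
  refine mul_le_of_le_one_right (zero_le) ?_
  rw [EReal.exp_le_one_iff, EReal.neg_le_zero]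
  exact EReal.coe_ennreal_nonneg a

lemma toENNReal_neg_log_expNeg (c : ℝ) (a : ℝ≥0∞) :
    (-ENNReal.log (expNeg c a / EReal.exp ((2 * c : ℝ) : EReal))).toENNReal = a := by
  rw [expNeg, mul_comm, ENNReal.mul_div_cancel_right (exp_coe_ne_zero c) (exp_coe_ne_top c),
    EReal.log_exp, neg_neg, EReal.toENNReal_coe]

/-- `expNeg c` has the continuous left inverse of `toENNReal_neg_log_expNeg`. -/
lemma tendsto_of_tendsto_expNeg {c : ℝ} {ι : Type*} {L : Filter ι} {u : ι → ℝ≥0∞} {a : ℝ≥0∞}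
    (h : Tendsto (fun i => expNeg c (u i)) L (𝓝 (expNeg c a))) : Tendsto u L (𝓝 a) := by
  have hcont : Continuous fun y : ℝ≥0∞ =>
      (-ENNReal.log (y / EReal.exp ((2 * c : ℝ) : EReal))).toENNReal :=
    EReal.continuous_toENNReal.comp (continuous_neg.comp (ENNReal.continuous_log.comp
      (ENNReal.continuous_div_const _ (exp_coe_ne_zero c))))
  have := (hcont.tendsto _).comp h
  simpa only [Function.comp_def, toENNReal_neg_log_expNeg] using this

lemma exp_neg_coe_sub (c : ℝ) (a : ℝ≥0∞) :
    EReal.exp (-((a : EReal) - ((2 * c : ℝ) : EReal))) = expNeg c a := by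
  rw [EReal.neg_sub (.inr (EReal.coe_ne_bot _)) (.inr (EReal.coe_ne_top _)), add_comm,
    EReal.exp_add, expNeg]

lemma minEnergy_eq {c : ℝ} (hc : 0 ≤ c) (h : IsSphereBound Q c) (hQ : LowerSemicontinuous Q) :
    minEnergy Q = ((⨅ μ : ProbabilityMeasure K, energy (weightedKernel Q c) (μ : Measure K) : ℝ≥0∞)
      : EReal) - ((2 * c : ℝ) : EReal) := by
  have hmono : Monotone fun a : ℝ≥0∞ => (a : EReal) - ((2 * c : ℝ) : EReal) := fun a b hab =>
    EReal.sub_le_sub (EReal.coe_ennreal_le_coe_ennreal_iff.2 hab) le_rfl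
  have hcont : Continuous fun a : ℝ≥0∞ => (a : EReal) - ((2 * c : ℝ) : EReal) := by
    rw [continuous_iff_continuousAt]
    intro a
    simp only [sub_eq_add_neg, ← EReal.coe_neg]
    exact (EReal.continuousAt_add (.inr (EReal.coe_ne_bot _)) (.inr (EReal.coe_ne_top _))).comp
      ((continuous_coe_ennreal_ereal.prodMk continuous_const).continuousAt)
  simp only [minEnergy, weightedEnergy_eq hc h hQ]
  exact (hmono.map_iInf_of_continuousAt hcont.continuousAt (EReal.top_sub_coe _)).symm

lemma sum_sum_erase_eq {k : ℕ} {M : Type*} [AddCommMonoid M] (f : Fin k → Fin k → M)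
    (hf : ∀ i j, f i j = f j i) :
    ∑ i, ∑ j ∈ Finset.univ.erase i, f i j = 2 • ∑ i, ∑ j ∈ Finset.Ioi i, f i j := by
  have h1 : ∀ i : Fin k, ∑ j ∈ Finset.univ.erase i, f i j =
      ∑ j ∈ Finset.Iio i, f i j + ∑ j ∈ Finset.Ioi i, f i j := by
    intro i
    rw [← Finset.sum_union (Finset.disjoint_left.2 fun j h1 h2 =>
      lt_asymm (Finset.mem_Iio.1 h1) (Finset.mem_Ioi.1 h2))]
    congr 1
    ext j
    simp [lt_or_lt_iff_ne]
  simp_rw [h1, Finset.sum_add_distrib, two_nsmul]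
  congr 1
  rw [Finset.sum_comm' (t' := Finset.univ) (s' := fun j => Finset.Ioi j) (by simp)]
  simp_rw [hf]

lemma exp_neg_add (a b : ℝ≥0∞) : EReal.exp (-((a + b : ℝ≥0∞) : EReal)) =
    EReal.exp (-(a : EReal)) * EReal.exp (-(b : EReal)) := by
  rw [EReal.coe_ennreal_add, EReal.neg_add (.inl (EReal.coe_ennreal_ne_bot _))
    (.inr (EReal.coe_ennreal_ne_bot _)), sub_eq_add_neg, EReal.exp_add]

lemma exp_neg_sum {ι : Type*} (s : Finset ι) (f : ι → ℝ≥0∞) :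
    EReal.exp (-((∑ i ∈ s, f i : ℝ≥0∞) : EReal)) = ∏ i ∈ s, EReal.exp (-(f i : EReal)) := by
  classical
  induction s using Finset.induction_on with
  | empty => simp
  | insert i s hi ih => rw [Finset.sum_insert hi, Finset.prod_insert hi, exp_neg_add, ih]

/-- With `m = k (k - 1) / 2` pairs, the Vandermonde is `e^{2cm} e^{-S}` and the exponent is `1 / m`,
which turns the sum `S` into the mean over pairs. -/
lemma normalizedVDM_eq {c : ℝ} (h : IsSphereBound Q c) {k : ℕ} (hk : 2 ≤ k) (x : Fin k → K) :
    normalizedVDM Q x = expNeg c (discreteEnergy (weightedKernel Q c) x) := by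
  obtain ⟨S, hS⟩ : ∃ S, S = ∑ i, ∑ j ∈ Finset.Ioi i, weightedKernel Q c (x i, x j) := ⟨_, rfl⟩
  obtain ⟨m, hm⟩ : ∃ m, m = ∑ i : Fin k, ∑ j ∈ Finset.Ioi i, 1 := ⟨_, rfl⟩
  obtain ⟨A, hA⟩ : ∃ A, A = EReal.exp ((2 * c : ℝ) : EReal) := ⟨_, rfl⟩
  have hV : weightedVDM Q x = A ^ m * EReal.exp (-(S : EReal)) := by
    simp only [weightedVDM, weight_product_eq h, Finset.prod_mul_distrib, hS, exp_neg_sum, hm,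
      ← Finset.prod_pow_eq_pow_sum, pow_one, hA]
  have hT := sum_sum_erase_eq (fun i j => weightedKernel Q c (x i, x j))
    fun i j => weightedKernel_swap Q c _ _
  rw [← hS] at hT
  have h2m : k * (k - 1) = 2 * m := by
    have := sum_sum_erase_eq (fun _ _ : Fin k => 1) fun _ _ => rfl
    simpa [hm, Finset.card_erase_of_mem] using this
  have hmpos : 0 < m := by
    have : 0 < k * (k - 1) := Nat.mul_pos (by omega) (by omega)
    omega
  have hr : 2 / ((k : ℝ) * ((k : ℝ) - 1)) = (m : ℝ)⁻¹ := by
    have : (k : ℝ) * ((k : ℝ) - 1) = 2 * m := by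
      rw [← Nat.cast_pred (by omega)]
      exact_mod_cast h2m
    rw [this]
    field_simp
  have hD : discreteEnergy (weightedKernel Q c) x = S * ENNReal.ofReal (m : ℝ)⁻¹ := by
    have hm0 : (m : ℝ≥0∞) ≠ 0 := by exact_mod_cast hmpos.ne'
    rw [discreteEnergy, hT, ← Nat.cast_mul, h2m, ENNReal.ofReal_inv_of_pos (by positivity),
      ENNReal.ofReal_natCast, nsmul_eq_mul, Nat.cast_mul, ← div_eq_mul_inv]
    exact ENNReal.mul_div_mul_left _ _ (by simp) (by simp)
  rw [normalizedVDM, hV, hr, ENNReal.mul_rpow_of_nonneg _ _ (by positivity), expNeg, hD, ← hA]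
  congr 1
  · rw [← ENNReal.rpow_natCast, ← ENNReal.rpow_mul, mul_inv_cancel₀ (by positivity),
      ENNReal.rpow_one]
  · rw [← EReal.exp_mul, EReal.coe_ennreal_mul, EReal.coe_ennreal_ofReal,
      max_eq_left (by positivity), EReal.neg_mul]

lemma toMeasure_empiricalMeasure {k : ℕ} (hk : k ≠ 0) (x : Fin k → K) :
    (empiricalMeasure x : Measure K) = normalizedCount x := by
  have : (k : ℝ≥0) ≠ 0 := by exact_mod_cast hk
  rw [empiricalMeasure, normalizedCount, FiniteMeasure.toMeasure_smul,
    FiniteMeasure.toMeasure_sum]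
  simp [ENNReal.smul_def, ENNReal.coe_inv this]
  rfl

end Translation

end

/-! ### Uniqueness of the minimizer -/

noncomputable section

section Uniqueness

variable {K : Set ℂ} {Q : K → EReal}

lemma lintegral_weightedKernel (hQ : LowerSemicontinuous Q) (c : ℝ) (μ ν : Measure K)
    [IsProbabilityMeasure μ] [IsProbabilityMeasure ν] :
    ∫⁻ p, weightedKernel Q c p ∂μ.prod ν = chordalEnergy μ ν +
      (∫⁻ z, sphereField Q c z ∂μ + ∫⁻ z, sphereField Q c z ∂ν) := by
  have hm := (lowerSemicontinuous_sphereField hQ c).measurable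
  unfold weightedKernel
  rw [lintegral_add_left measurable_chordalKernel,
    lintegral_add_left (show Measurable fun p : K × K => sphereField Q c p.1 from
      hm.comp measurable_fst)]
  congr 2
  · have := lintegral_map (μ := μ.prod ν) hm measurable_fst
    rw [Measure.map_fst_prod, measure_univ, one_smul] at this
    exact this.symm
  · have := lintegral_map (μ := μ.prod ν) hm measurable_snd
    rw [Measure.map_snd_prod, measure_univ, one_smul] at this
    exact this.symm

/-- The midpoint of two probability measures. -/
def midpointMeasure {X : Type*} [MeasurableSpace X] (μ ν : ProbabilityMeasure X) :
    ProbabilityMeasure X :=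
  ⟨(2⁻¹ : ℝ≥0∞) • ((μ : Measure X) + (ν : Measure X)), ⟨by
    simp only [Measure.smul_apply, Measure.add_apply, measure_univ, smul_eq_mul]
    rw [one_add_one_eq_two, ENNReal.inv_mul_cancel two_ne_zero ENNReal.ofNat_ne_top]⟩⟩

lemma four_mul_energy_midpointMeasure {X : Type*} [MeasurableSpace X] (h : X × X → ℝ≥0∞)
    (μ ν : ProbabilityMeasure X) :
    4 * energy h (midpointMeasure μ ν : Measure X) =
      energy h (μ : Measure X) + energy h (ν : Measure X) +
        (∫⁻ p, h p ∂(μ : Measure X).prod ν + ∫⁻ p, h p ∂(ν : Measure X).prod μ) := by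
  have h4 : (4 : ℝ≥0∞) * (2⁻¹ * 2⁻¹) = 1 := by
    rw [← ENNReal.mul_inv (.inl two_ne_zero) (.inl ENNReal.ofNat_ne_top)]
    norm_num
    exact ENNReal.mul_inv_cancel (by norm_num) ENNReal.ofNat_ne_top
  change 4 * ∫⁻ p, h p ∂((2⁻¹ : ℝ≥0∞) • ((μ : Measure X) + (ν : Measure X))).prod
    ((2⁻¹ : ℝ≥0∞) • ((μ : Measure X) + (ν : Measure X))) = _
  rw [Measure.prod_smul_left, Measure.prod_smul_right, smul_smul, lintegral_smul_measure,
    smul_eq_mul, ← mul_assoc, h4, one_mul, Measure.prod_add, Measure.add_prod, Measure.add_prod,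
    lintegral_add_measure, lintegral_add_measure, lintegral_add_measure]
  simp only [energy]
  ring

/-- Uniqueness of the measure of least weighted energy. -/
lemma eq_of_energy_le [PolishSpace K] (hQ : LowerSemicontinuous Q) (c : ℝ)
    (hV : ⨅ μ : ProbabilityMeasure K, energy (weightedKernel Q c) (μ : Measure K) ≠ ⊤)
    {μ ν : ProbabilityMeasure K}
    (hμ : energy (weightedKernel Q c) (μ : Measure K) ≤
      ⨅ μ : ProbabilityMeasure K, energy (weightedKernel Q c) (μ : Measure K))
    (hν : energy (weightedKernel Q c) (ν : Measure K) ≤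
      ⨅ μ : ProbabilityMeasure K, energy (weightedKernel Q c) (μ : Measure K)) : μ = ν := by
  set V := ⨅ μ : ProbabilityMeasure K, energy (weightedKernel Q c) (μ : Measure K)
  have hmid : V ≤ energy (weightedKernel Q c) (midpointMeasure μ ν : Measure K) := iInf_le _ _
  have h4 := four_mul_energy_midpointMeasure (weightedKernel Q c) μ ν
  have hsum : energy (weightedKernel Q c) (μ : Measure K) +
      energy (weightedKernel Q c) (ν : Measure K) ≤ 2 * V := by
    rw [two_mul]; exact add_le_add hμ hν
  -- The midpoint has energy at least `V`. Its expansion contains both self-energies, at most `2V`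
  -- together, so the cross terms supply the other `2V`.
  have hcross : 2 * V ≤ ∫⁻ p, weightedKernel Q c p ∂(μ : Measure K).prod ν +
      ∫⁻ p, weightedKernel Q c p ∂(ν : Measure K).prod μ := by
    have : 2 * V + 2 * V ≤ 2 * V + (∫⁻ p, weightedKernel Q c p ∂(μ : Measure K).prod ν +
        ∫⁻ p, weightedKernel Q c p ∂(ν : Measure K).prod μ) := by
      calc 2 * V + 2 * V = 4 * V := by ring
        _ ≤ _ := by
          exact (mul_le_mul_right hmid 4).trans (h4.le.trans (add_le_add hsum le_rfl))
    exact (ENNReal.add_le_add_iff_left (ENNReal.mul_ne_top ENNReal.ofNat_ne_top hV)).1 this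
  have hle := hsum.trans hcross
  have hfin := ne_top_of_le_ne_top (ENNReal.mul_ne_top ENNReal.ofNat_ne_top hV) hsum
  simp only [energy, lintegral_weightedKernel hQ c] at hle hfin
  generalize hF : ∫⁻ z, sphereField Q c z ∂(μ : Measure K) = F at hle hfin
  generalize hG : ∫⁻ z, sphereField Q c z ∂(ν : Measure K) = G at hle hfin
  -- The fields contribute the same finite amount to the self and cross terms; cancelling it leaves
  -- chordal energies only.
  have hFG : F + G + (F + G) ≠ ⊤ := by
    refine ne_top_of_le_ne_top hfin ?_
    calc F + G + (F + G) = (F + F) + (G + G) := by ring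
      _ ≤ _ := add_le_add le_add_self le_add_self
  refine Subtype.ext (eq_of_chordalEnergy_le (μ := (μ : Measure K)) (ν := (ν : Measure K))
    (ne_top_of_le_ne_top hfin (add_le_add le_self_add le_self_add)) ?_)
  refine (ENNReal.add_le_add_iff_right hFG).1 ?_
  calc _ = _ := ?_
    _ ≤ _ := hle
    _ = _ := ?_
  · ring
  · ring

end Uniqueness

/-! ### Finiteness of the minimal energy -/

section Finiteness

lemma chordalKernel_le {z t : ℂ} {R : ℝ} (hz : ‖z‖ ≤ R) (ht : ‖t‖ ≤ R) :
    chordalKernel z t ≤ (ENNReal.log (edist z t)⁻¹).toENNReal +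
      ENNReal.ofReal (Real.log (1 + R ^ 2)) := by
  rcases eq_or_ne z t with rfl | h
  · simp
  have hpos : 0 < ‖z - t‖ := norm_pos_iff.2 (sub_ne_zero.2 h)
  rw [edist_dist, dist_eq_norm, ENNReal.log_inv, ENNReal.log_ofReal_of_pos hpos, ← EReal.coe_neg,
    EReal.real_coe_toENNReal, chordalKernel_eq_log h, neg_log_one_sub_sphereOverlap h]
  refine le_trans (ENNReal.ofReal_le_ofReal ?_) ENNReal.ofReal_add_le
  linarith [sphereWeight_le_of_norm_le hz, sphereWeight_le_of_norm_le ht]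

lemma toENNReal_neg_log_le {z t : ℂ} {R : ℝ} (hz : ‖z‖ ≤ R) (ht : ‖t‖ ≤ R) :
    (-ENNReal.log (edist z t)⁻¹).toENNReal ≤ ENNReal.ofReal (2 * R) := by
  rcases eq_or_ne z t with rfl | h
  · simp
  have hpos : 0 < ‖z - t‖ := norm_pos_iff.2 (sub_ne_zero.2 h)
  rw [edist_dist, dist_eq_norm, ENNReal.log_inv, neg_neg, ENNReal.log_ofReal_of_pos hpos,
    EReal.real_coe_toENNReal]
  refine ENNReal.ofReal_le_ofReal ?_
  linarith [Real.log_le_sub_one_of_pos hpos, norm_sub_le z t]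

/-- On a bounded set the negative part of the logarithmic kernel is bounded, so finite energy means
an integrable positive part, which dominates the chordal kernel up to a constant. -/
lemma chordalEnergy_ne_top_of_logEnergy_ne_top {C : Set ℂ} (hC : IsCompact C)
    {μ : ProbabilityMeasure C} (hμ : logEnergy μ ≠ ⊤) :
    chordalEnergy (μ : Measure C) (μ : Measure C) ≠ ⊤ := by
  obtain ⟨R, hR⟩ := hC.isBounded.exists_norm_le
  have hN : ∫⁻ p : C × C, (-ENNReal.log (edist p.1 p.2)⁻¹).toENNReal
      ∂(μ : Measure C).prod μ ≠ ⊤ := by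
    refine ne_top_of_le_ne_top (ENNReal.ofReal_ne_top (r := 2 * R)) ?_
    calc _ ≤ ∫⁻ p : C × C, ENNReal.ofReal (2 * R) ∂(μ : Measure C).prod μ :=
          lintegral_mono fun p => toENNReal_neg_log_le (hR _ p.1.2) (hR _ p.2.2)
      _ = _ := by simp
  have hP : ∫⁻ p : C × C, (ENNReal.log (edist p.1 p.2)⁻¹).toENNReal
      ∂(μ : Measure C).prod μ ≠ ⊤ := by
    intro hP
    refine hμ ?_
    rw [logEnergy, erealIntegral, hP, EReal.coe_ennreal_top]
    lift ∫⁻ p : C × C, (-ENNReal.log (edist p.1 p.2)⁻¹).toENNReal ∂(μ : Measure C).prod μ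
      to ℝ≥0 using hN with N
    rw [EReal.coe_nnreal_eq_coe_real, EReal.top_sub_coe]
  refine ne_top_of_le_ne_top (ENNReal.add_ne_top.2
    ⟨hP, ENNReal.ofReal_ne_top (r := Real.log (1 + R ^ 2))⟩) ?_
  calc chordalEnergy (μ : Measure C) (μ : Measure C)
      ≤ ∫⁻ p : C × C, ((ENNReal.log (edist p.1 p.2)⁻¹).toENNReal +
          ENNReal.ofReal (Real.log (1 + R ^ 2))) ∂(μ : Measure C).prod μ :=
        lintegral_mono fun p => chordalKernel_le (hR _ p.1.2) (hR _ p.2.2)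
    _ = _ := by rw [lintegral_add_right _ measurable_const]; simp

variable {K : Set ℂ} {Q : K → EReal}

lemma sphereField_ne_top {c : ℝ} {z : K} (h : Q z ≠ ⊤) : sphereField Q c z ≠ ⊤ := by
  rw [sphereField, EReal.toENNReal_ne_top_iff]
  exact EReal.add_ne_top h (EReal.coe_ne_top _)

lemma chordalEnergy_map {C : Set ℂ} {j : C → K} (hj : Measurable j) (hjv : ∀ z, (j z : ℂ) = z)
    (μ ν : Measure C) [SFinite μ] [SFinite ν] :
    chordalEnergy (μ.map j) (ν.map j) = chordalEnergy μ ν := by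
  rw [chordalEnergy, Measure.map_prod_map _ _ hj hj,
    lintegral_map measurable_chordalKernel (hj.prodMap hj)]
  simp only [Prod.map_fst, Prod.map_snd, hjv]
  rfl

/-- Nonpolarity gives a measure of finite chordal energy carried by `{Q < ∞}`. The field may fail to
be integrable there, so the measure is restricted to a set of positive mass where the field is at
most `n`, then normalized. -/
lemma iInf_energy_ne_top (hQ : LowerSemicontinuous Q) (c : ℝ)
    (hnp : ¬ IsPolar {z : ℂ | ∃ h : z ∈ K, Q ⟨z, h⟩ < ⊤}) :
    ⨅ μ : ProbabilityMeasure K, energy (weightedKernel Q c) (μ : Measure K) ≠ ⊤ := by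
  unfold IsPolar at hnp
  push Not at hnp
  obtain ⟨C, hCsub, hC, μ, hμ⟩ := hnp
  have hchord := chordalEnergy_ne_top_of_logEnergy_ne_top hC hμ
  choose hCK hCQ using hCsub
  let j : C → K := fun z => ⟨z, hCK z.2⟩
  have hj : Measurable j := measurable_subtype_coe.subtype_mk
  have hφ : Measurable fun z => sphereField Q c (j z) :=
    (lowerSemicontinuous_sphereField hQ c).measurable.comp hj
  have hφt : ∀ z, sphereField Q c (j z) ≠ ⊤ := fun z => sphereField_ne_top (hCQ z.2).ne
  let T : ℕ → Set C := fun n => {z | sphereField Q c (j z) ≤ n}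
  obtain ⟨n, hn⟩ : ∃ n, (μ : Measure C) (T n) ≠ 0 := by
    by_contra hcon
    push Not at hcon
    have h0 := measure_iUnion_null hcon
    have hU : ⋃ n, T n = Set.univ := by
      refine Set.eq_univ_of_forall fun z => Set.mem_iUnion.2 ?_
      obtain ⟨n, hn⟩ := ENNReal.exists_nat_gt (hφt z)
      exact ⟨n, hn.le⟩
    rw [hU, measure_univ] at h0
    exact one_ne_zero h0
  have hT : MeasurableSet (T n) := measurableSet_le hφ measurable_const
  let a : ℝ≥0∞ := ((μ : Measure C) (T n))⁻¹
  have ha : a ≠ ⊤ := ENNReal.inv_ne_top.2 hn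
  let ν : Measure C := a • (μ : Measure C).restrict (T n)
  have hν : IsProbabilityMeasure ν := ⟨by
    simp [ν, a, ENNReal.inv_mul_cancel hn (measure_ne_top _ _)]⟩
  have hκ : IsProbabilityMeasure (ν.map j) := Measure.isProbabilityMeasure_map hj.aemeasurable
  refine ne_top_of_le_ne_top ?_ (iInf_le _ (⟨ν.map j, hκ⟩ : ProbabilityMeasure K))
  change energy (weightedKernel Q c) (ν.map j) ≠ ⊤
  rw [energy, lintegral_weightedKernel hQ c, chordalEnergy_map hj fun _ => rfl,
    lintegral_map (lowerSemicontinuous_sphereField hQ c).measurable hj]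
  have h1 : chordalEnergy ν ν ≠ ⊤ := by
    simp only [ν]
    rw [chordalEnergy, Measure.prod_smul_left, Measure.prod_smul_right, smul_smul,
      lintegral_smul_measure, smul_eq_mul, Measure.prod_restrict]
    exact ENNReal.mul_ne_top (ENNReal.mul_ne_top ha ha)
      (ne_top_of_le_ne_top hchord (setLIntegral_le_lintegral _ _))
  have h2 : ∫⁻ z, sphereField Q c (j z) ∂ν ≠ ⊤ := by
    simp only [ν]
    rw [lintegral_smul_measure, smul_eq_mul]
    refine ENNReal.mul_ne_top ha (ne_top_of_le_ne_top (ENNReal.natCast_ne_top n) ?_)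
    calc ∫⁻ z in T n, sphereField Q c (j z) ∂(μ : Measure C)
        ≤ ∫⁻ z in T n, (n : ℝ≥0∞) ∂(μ : Measure C) :=
          setLIntegral_mono measurable_const fun z hz => hz
      _ ≤ n := by
        rw [setLIntegral_const]
        exact mul_le_of_le_one_right (zero_le) prob_le_one
  exact ENNReal.add_ne_top.2 ⟨h1, ENNReal.add_ne_top.2 ⟨h2, h2⟩⟩

end Finiteness

/-! ### Limits of Vandermondes and conclusion -/

section Final

variable {K : Set ℂ} {Q : K → EReal}

/-- Weak convergence of the empirical measures, in terms of probability measures. -/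
lemma tendsto_empiricalMeasure_iff {x : (k : ℕ) → Fin k → K} {P : ℕ → ProbabilityMeasure K}
    (hP : ∀ᶠ k in atTop, (P k : Measure K) = normalizedCount (x k)) (μ : ProbabilityMeasure K) :
    Tendsto (fun k => empiricalMeasure (x k)) atTop (𝓝 μ.toFiniteMeasure) ↔
      Tendsto P atTop (𝓝 μ) := by
  rw [ProbabilityMeasure.tendsto_nhds_iff_toFiniteMeasure_tendsto_nhds]
  refine tendsto_congr' ?_
  filter_upwards [hP, eventually_ne_atTop 0] with k hk hk0
  exact Subtype.ext ((toMeasure_empiricalMeasure hk0 (x k)).trans hk.symm)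

/-- Being continuous and antitone, `expNeg c` turns the liminf bound on discrete energies into a
limsup bound. -/
lemma limsup_normalizedVDM_le {c : ℝ} (hc : 0 ≤ c) (hb : IsSphereBound Q c)
    (hQ : LowerSemicontinuous Q) {x : (k : ℕ) → Fin k → K} {μ : ProbabilityMeasure K}
    (hx : Tendsto (fun k => empiricalMeasure (x k)) atTop (𝓝 μ.toFiniteMeasure)) :
    limsup (fun k => normalizedVDM Q (x k)) atTop ≤ EReal.exp (-weightedEnergy Q μ) := by
  have : Nonempty K := by
    by_contra hK
    rw [not_nonempty_iff] at hK
    have := μ.2.measure_univ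
    simp [Set.univ_eq_empty_iff.2 hK] at this
  obtain ⟨P, hP⟩ := exists_probabilityMeasure_eq_normalizedCount x
  rw [tendsto_empiricalMeasure_iff hP] at hx
  have hlow := fun a (ha : a < energy (weightedKernel Q c) (μ : Measure K)) =>
    eventually_lt_discreteEnergy (lowerSemicontinuous_weightedKernel hQ c) hP le_rfl hx ha
  have hliminf : energy (weightedKernel Q c) (μ : Measure K) ≤
      liminf (fun k => discreteEnergy (weightedKernel Q c) (x k)) atTop :=
    le_of_forall_lt fun a ha => by
      obtain ⟨b, hab, hb⟩ := exists_between ha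
      exact hab.trans_le (le_liminf_of_le (by isBoundedDefault) ((hlow b hb).mono fun _ h => h.le))
  rw [weightedEnergy_eq hc hb hQ, exp_neg_coe_sub,
    limsup_congr ((eventually_ge_atTop 2).mono fun k hk => normalizedVDM_eq hb hk (x k))]
  refine le_trans (le_of_eq ?_) (antitone_expNeg c hliminf)
  exact ((antitone_expNeg c).map_liminf_of_continuousAt
    (fun k => discreteEnergy (weightedKernel Q c) (x k))
    (continuous_expNeg c).continuousAt).symm

lemma weightedDiameter_eq {c : ℝ} (hb : IsSphereBound Q c) {k : ℕ} (hk : 2 ≤ k) :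
    weightedDiameter Q k = expNeg c (⨅ x : Fin k → K, discreteEnergy (weightedKernel Q c) x) := by
  simp only [weightedDiameter, normalizedVDM_eq hb hk]
  refine ((antitone_expNeg c).map_iInf_of_continuousAt (continuous_expNeg c).continuousAt ?_).symm
  simp [expNeg]

end Final

end

end LogPotential

theorem theorem3p5 (K : Set ℂ) (hK : IsClosed K) (hKnp : ¬ IsPolar K)
    (Q : K → EReal) (hQ : IsWeaklyAdmissible Q) :
    -- the weighted diameters are finite
    (∀ k : ℕ, 2 ≤ k → weightedDiameter Q k < ⊤) ∧
    -- the upper bound along weakly convergent configurations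
    (∀ (x : (k : ℕ) → Fin k → K) (μ : ProbabilityMeasure K),
      Tendsto (fun k => empiricalMeasure (x k)) atTop (𝓝 μ.toFiniteMeasure) →
      limsup (fun k => normalizedVDM Q (x k)) atTop ≤ EReal.exp (-weightedEnergy Q μ)) ∧
    -- the minimal energy is finite and the weighted diameters converge
    (minEnergy Q ≠ ⊥ ∧ minEnergy Q ≠ ⊤ ∧
      Tendsto (fun k => weightedDiameter Q k) atTop (𝓝 (EReal.exp (-minEnergy Q)))) ∧
    -- the equilibrium measure exists, is unique, and attracts asymptotically extremal points
    (∃ μKQ : ProbabilityMeasure K,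
      (∀ ν : ProbabilityMeasure K, weightedEnergy Q ν = minEnergy Q ↔ ν = μKQ) ∧
      ∀ x : (k : ℕ) → Fin k → K,
        Tendsto (fun k => normalizedVDM Q (x k)) atTop (𝓝 (EReal.exp (-minEnergy Q))) →
        Tendsto (fun k => empiricalMeasure (x k)) atTop (𝓝 μKQ.toFiniteMeasure)) := by
  have hpolish : PolishSpace K := hK.polishSpace
  have hlsc := hQ.lowerSemicontinuous
  obtain ⟨c, hc, hb⟩ := hQ.exists_isSphereBound hK
  have hh := lowerSemicontinuous_weightedKernel hlsc c
  have hcoer := isCoerciveKernel_weightedKernel hK Q c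
  have hV := iInf_energy_ne_top hlsc c hQ.nonpolar
  obtain ⟨hlim, μ₀, hμ₀⟩ := exists_tendsto_discreteEnergy_iInf hh hcoer hV
  have huniq : ∀ ν : ProbabilityMeasure K, energy (weightedKernel Q c) (ν : Measure K) ≤
      ⨅ μ : ProbabilityMeasure K, energy (weightedKernel Q c) (μ : Measure K) → ν = μ₀ :=
    fun ν hν => eq_of_energy_le hlsc c hV hν hμ₀.le
  have hmin := minEnergy_eq hc hb hlsc
  have hexp := exp_neg_coe_sub c
    (⨅ μ : ProbabilityMeasure K, energy (weightedKernel Q c) (μ : Measure K))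
  rw [← hmin] at hexp
  have hne : Nonempty K := by
    by_contra hK
    rw [not_nonempty_iff] at hK
    have := μ₀.2.measure_univ
    simp [Set.univ_eq_empty_iff.2 hK] at this
  refine ⟨fun k hk => ?_, fun x μ hx => limsup_normalizedVDM_le hc hb hlsc hx, ⟨?_, ?_, ?_⟩,
    μ₀, fun ν => ⟨fun hν => huniq ν ?_, ?_⟩, fun x hx => ?_⟩
  · rw [weightedDiameter_eq hb hk]
    exact (expNeg_le c _).trans_lt (exp_coe_ne_top c).lt_top
  · rw [hmin]
    lift (⨅ μ : ProbabilityMeasure K, energy (weightedKernel Q c) (μ : Measure K)) to ℝ≥0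
      using hV with V
    rw [EReal.coe_nnreal_eq_coe_real, ← EReal.coe_sub]
    exact EReal.coe_ne_bot _
  · rw [hmin]
    lift (⨅ μ : ProbabilityMeasure K, energy (weightedKernel Q c) (μ : Measure K)) to ℝ≥0
      using hV with V
    rw [EReal.coe_nnreal_eq_coe_real, ← EReal.coe_sub]
    exact EReal.coe_ne_top _
  · rw [hexp]
    refine (((continuous_expNeg c).tendsto _).comp hlim).congr' ?_
    exact (eventually_ge_atTop 2).mono fun k hk => (weightedDiameter_eq hb hk).symm
  · rw [hmin, weightedEnergy_eq hc hb hlsc] at hν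
    -- The shift by `2c` is undone through `expNeg c` and its left inverse.
    have := congrArg (fun y : EReal => EReal.exp (-y)) hν
    simp only [exp_neg_coe_sub] at this
    have h2 := congrArg
      (fun y => (-ENNReal.log (y / EReal.exp ((2 * c : ℝ) : EReal))).toENNReal) this
    simp only [toENNReal_neg_log_expNeg] at h2
    exact h2.le
  · rintro rfl
    rw [weightedEnergy_eq hc hb hlsc, hmin, hμ₀]
  · obtain ⟨P, hP⟩ := exists_probabilityMeasure_eq_normalizedCount x
    rw [tendsto_empiricalMeasure_iff hP]
    refine tendsto_of_tendsto_discreteEnergy hh hcoer hP hV huniq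
      (tendsto_of_tendsto_expNeg (c := c) ?_)
    rw [hexp] at hx
    exact hx.congr' ((eventually_ge_atTop 2).mono fun k hk => normalizedVDM_eq hb hk (x k))
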